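/- **Planar code states are bipartite circle graph states.** Let $P$ be a plane multigraph: a finite multigraph (loops and parallel edges allowed, not necessarily connected) embedded in the sphere, given by its cyclic orders of edge-ends around the vertices and its faces (for connected $P$: a combinatorial map with $|V|-|E|+|F|=2$). Place a qubit on each edge of $P$. A *planar code state* of $P$ is a unit vector fixed by $\bigotimes_{e} Z_e^{m_f(e)}$ for every face $f$ (including the exterior one) and $\bigotimes_{e} X_e^{m_v(e)}$ for every vertex $v$, where $m_f(e)\in\{0,1,2\}$ is the number of sides of $e$ on $f$ and $m_v(e)\in\{0,1,2\}$ is the number of ends of $e$ at $v$. The *graph state* of a finite simple graph $G$ is $|G\rangle=\prod_{\{a,b\}\in E(G)}CZ_{ab}\,|+\rangle^{\otimes V(G)}$. Two states are *LC-equivalent* if one is obtained from the other by a tensor product of one-qubit Clifford unitaries, up to a global phase. A *circle graph* is the intersection graph of finitely many chords of a circle, with pairwise distinct endpoints. For a spanning tree $T$ of $P$ (if $P$ is disconnected: a union of spanning trees of its components), the *fundamental graph* of $P$ with respect to $T$ is the bipartite graph whose vertices are the edges of $P$, in which $a\notin T$ and $t\in T$ are adjacent if $t$ lies on the unique cycle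 in $T\cup\{a\}$. 1. Every plane multigraph $P$ has a planar code state $|\psi\rangle$, unique up to a global phase, and $|\psi\rangle$ is LC-equivalent to $|G\rangle$ for some bipartite circle graph $G$ on the edges of $P$. More precisely, such a $T$ exists, and for every such $T$ the fundamental graph $G$ of $P$ with respect to $T$ is a bipartite circle graph, and applying Hadamard gates to all qubits outside $T$ transforms $|\psi\rangle$ into $|G\rangle$ up to a global phase. 2. Conversely, for every bipartite circle graph $G$ the state $|G\rangle$ is LC-equivalent to a planar code state of a connected plane multigraph whose edges are the vertices of $G$. -/

import Mathlib

universe u v w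

/-! ### Qubit states and local operators -/

/-- A state vector on the qubits labelled by `Q`: amplitudes on the computational basis. -/
abbrev QState (Q : Type*) : Type _ := (Q → Fin 2) → ℂ

/-- A linear operator on one qubit. -/
abbrev QubitOp : Type := Matrix (Fin 2) (Fin 2) ℂ

def pauliX : QubitOp := !![0, 1; 1, 0]

def pauliY : QubitOp := !![0, -Complex.I; Complex.I, 0]

def pauliZ : QubitOp := !![1, 0; 0, -1]

noncomputable def hadamard : QubitOp :=
  ((1 / Real.sqrt 2 : ℝ) : ℂ) • !![1, 1; 1, -1]

/-- The one-qubit Pauli group: the sixteen matrices `i ^ k • P` with `P ∈ {I, X, Y, Z}`. -/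
def pauliGroup : Set QubitOp :=
  {A | ∃ k : ℕ, ∃ P ∈ ({1, pauliX, pauliY, pauliZ} : Set QubitOp), A = Complex.I ^ k • P}

/-- One-qubit Clifford operators: the unitaries `U` with `U 𝒫 U† = 𝒫`. -/
def IsClifford (U : QubitOp) : Prop :=
  U ∈ Matrix.unitaryGroup (Fin 2) ℂ ∧
    (fun A : QubitOp => U * A * U.conjTranspose) '' pauliGroup = pauliGroup

/-- The tensor product `⨂ q, A q` of one-qubit operators, as a matrix in the computational
basis. -/
def tensorOp {Q : Type*} [Fintype Q] (A : Q → QubitOp) :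
    Matrix (Q → Fin 2) (Q → Fin 2) ℂ :=
  Matrix.of fun x y => ∏ q, A q (x q) (y q)

/-- Equality of two state vectors up to a global phase: `φ = e ^ (iθ) ψ`. -/
def EqUpToPhase {Q : Type*} (φ ψ : QState Q) : Prop :=
  ∃ θ : ℝ, φ = Complex.exp (Complex.I * θ) • ψ

/-- `ψ` and `φ` are equivalent under a tensor product of one-qubit Clifford operators, up to a
global phase. -/
def LCEquiv {Q : Type*} [Fintype Q] [DecidableEq Q] (ψ φ : QState Q) : Prop :=
  ∃ C : Q → QubitOp, (∀ q, IsClifford (C q)) ∧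
    EqUpToPhase φ ((tensorOp C).mulVec ψ)

/-! ### Graph states -/

/-- The state `|+⟩` on every qubit. -/
noncomputable def plusState (Q : Type*) [Fintype Q] : QState Q :=
  fun _ => ((1 / Real.sqrt 2 : ℝ) : ℂ) ^ Fintype.card Q

open scoped Classical in
/-- The product of the controlled-`Z` gates over the edges of `G`. The gate on the edge `{a, b}`
is diagonal, with entry `-1` at the basis vectors `x` with `x a = x b = 1`, and `1` elsewhere. -/
noncomputable def czProduct {Q : Type*} [Fintype Q] (G : SimpleGraph Q) :
    Matrix (Q → Fin 2) (Q → Fin 2) ℂ :=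
  Matrix.diagonal fun x => ∏ e ∈ G.edgeFinset, if ∀ q ∈ e, x q = 1 then -1 else 1

/-- The graph state `|G⟩`. -/
noncomputable def graphState {Q : Type*} [Fintype Q] [DecidableEq Q] (G : SimpleGraph Q) :
    QState Q :=
  (czProduct G).mulVec (plusState Q)

/-! ### Circle graphs -/

/-- `G` is a circle graph: its vertices can be represented by straight chords of the unit circle
(with pairwise distinct endpoints) such that two different vertices are adjacent exactly if their
chords intersect. -/
def IsCircleGraph {Q : Type*} (G : SimpleGraph Q) : Prop :=
  ∃ p : Q × Bool → Circle, Function.Injective p ∧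
    ∀ a b : Q, G.Adj a b ↔ a ≠ b ∧
      (segment ℝ (p (a, false) : ℂ) (p (a, true) : ℂ) ∩
        segment ℝ (p (b, false) : ℂ) (p (b, true) : ℂ)).Nonempty

/-! ### Plane multigraphs

A multigraph embedded in the sphere (equivalently, in the plane) is given combinatorially, by its
rotation system and its faces. Every edge `e` consists of two opposite darts `(e, false)` and
`(e, true)`. -/

/-- The opposite dart. -/
def revDart {E : Type*} (d : E × Bool) : E × Bool := (d.1, !d.2)

/-- Two vertices are joined by a walk that uses only edges of `S`, where `vert d` is the vertex
from which the dart `d` starts. -/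
def EdgeReach {V E : Type*} (vert : E × Bool → V) (S : Set E) : V → V → Prop :=
  Relation.EqvGen fun x y =>
    ∃ d : E × Bool, d.1 ∈ S ∧ vert d = x ∧ vert (revDart d) = y

/-- The number of connected components. -/
noncomputable def numComponents {V E : Type*} (vert : E × Bool → V) : ℕ :=
  Nat.card (Quot (EdgeReach vert Set.univ))

/-- A (not necessarily connected) multigraph with vertices `V` and edges `E`, embedded in the
sphere with faces `F`. Loops and parallel edges are allowed.

That the surface is the sphere is expressed by `linked` (the surface is connected) and by Euler's
formula `|V| - |E| + |F| = 1 + (number of components)`. For a connected multigraph this says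
that `|V| - |E| + |F| = 2`, and the faces are then exactly the orbits of `d ↦ rot (revDart d)`:
this is the usual notion of a combinatorial map of genus zero. For several components it says that
each component has genus zero and that the components and the faces form a tree, with one edge
for each boundary walk. -/
structure PlaneMultigraph (V : Type*) (E : Type*) (F : Type*) where
  /-- The vertex from which a dart starts. -/
  vert : E × Bool → V
  /-- The next dart in the cyclic order of the darts around a vertex. -/
  rot : Equiv.Perm (E × Bool)
  /-- The cycles of `rot` are the sets of darts that start at a common vertex. -/
  sameCycle_rot_iff : ∀ d d', rot.SameCycle d d' ↔ vert d = vert d'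
  /-- The face along the (fixed) side of a dart. The two darts of an edge belong to the two sides
  of that edge. -/
  face : E × Bool → F
  /-- The next dart along the boundary walk of a face belongs to the same face. -/
  face_next : ∀ d, face (rot (revDart d)) = face d
  /-- The face in which a vertex without darts lies (without meaning for the other vertices). -/
  pointFace : V → F
  /-- The surface is connected: all vertices and faces are linked through incidences. -/
  linked : ∀ x y : V ⊕ F, Relation.EqvGen
    (fun x y => ∃ a f, x = Sum.inl a ∧ y = Sum.inr f ∧
      ((∃ d, vert d = a ∧ face d = f) ∨ ((∀ d, vert d ≠ a) ∧ pointFace a = f))) x y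
  /-- Euler's formula. -/
  euler : Nat.card V + Nat.card F = Nat.card E + numComponents vert + 1

namespace PlaneMultigraph

variable {V E F : Type*} (P : PlaneMultigraph V E F)

/-- The multigraph is connected. -/
def Connected : Prop := Nonempty V ∧ ∀ x y, EdgeReach P.vert Set.univ x y

/-- `T` is a spanning forest with as many components as `P` (hence a spanning tree if `P` is
connected): it joins any two vertices that are joined in `P`, and it is acyclic, i.e. removing any
of its edges separates the ends of that edge. -/
def IsSpanningForest (T : Set E) : Prop :=
  (∀ x y, EdgeReach P.vert Set.univ x y → EdgeReach P.vert T x y) ∧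
    ∀ e ∈ T, ¬ EdgeReach P.vert (T \ {e}) (P.vert (e, false)) (P.vert (e, true))

/-- `C` is the edge set of a cycle: it is nonempty and connected, and each vertex has degree `0`
or `2` in it (a loop contributes `2` to the degree, so a loop is a cycle of length one). -/
def IsCycle (C : Set E) : Prop :=
  C.Nonempty ∧
    (∀ d d' : E × Bool, d.1 ∈ C → d'.1 ∈ C → EdgeReach P.vert C (P.vert d) (P.vert d')) ∧
    ∀ x, Set.ncard {d : E × Bool | d.1 ∈ C ∧ P.vert d = x} ∈ ({0, 2} : Set ℕ)

/-- The edge `t` lies on the fundamental cycle of the edge `a`, i.e. on the cycle that arises when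
`a` is added to `T`. -/
def OnFundamentalCycle (T : Set E) (a t : E) : Prop :=
  ∃ C, P.IsCycle C ∧ C ⊆ insert a T ∧ a ∈ C ∧ t ∈ C

/-- The fundamental graph of `P` with respect to `T`: its vertices are the edges of `P`, and
`a ∉ T` is adjacent to `t ∈ T` if `t` lies on the fundamental cycle of `a`. -/
def fundamentalGraph (T : Set E) : SimpleGraph E where
  Adj a b := (a ∉ T ∧ b ∈ T ∧ P.OnFundamentalCycle T a b) ∨
    (b ∉ T ∧ a ∈ T ∧ P.OnFundamentalCycle T b a)
  symm := ⟨fun _ _ h => h.symm⟩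
  loopless := ⟨fun _ h => h.elim (fun h => h.1 h.2.1) (fun h => h.1 h.2.1)⟩

/-- The stabilizer `⨂_{e ∈ ∂f} Z_e`. An edge with both sides on `f` counts twice, so that it
contributes `Z ^ 2 = 1`. -/
noncomputable def faceStabilizer [Fintype E] (f : F) : Matrix (E → Fin 2) (E → Fin 2) ℂ :=
  tensorOp fun e => pauliZ ^ Set.ncard {b : Bool | P.face (e, b) = f}

/-- The stabilizer `⨂_{e ∋ x} X_e`. A loop at `x` counts twice, so that it contributes
`X ^ 2 = 1`. -/
noncomputable def vertexStabilizer [Fintype E] (x : V) : Matrix (E → Fin 2) (E → Fin 2) ℂ :=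
  tensorOp fun e => pauliX ^ Set.ncard {b : Bool | P.vert (e, b) = x}

/-- `ψ` is the planar code state of `P`: a unit vector fixed by all face stabilizers and all
vertex stabilizers. -/
def IsCodeState [Fintype E] [DecidableEq E] (ψ : QState E) : Prop :=
  ∑ x, ‖ψ x‖ ^ 2 = 1 ∧
    (∀ f, (P.faceStabilizer f).mulVec ψ = ψ) ∧ ∀ x, (P.vertexStabilizer x).mulVec ψ = ψ

end PlaneMultigraph

open scoped Classical in
/-- Hadamard gates on the qubits in `S`, and the identity on the other qubits. -/
noncomputable def hadamardsOn {Q : Type*} [Fintype Q] (S : Set Q) :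
    Matrix (Q → Fin 2) (Q → Fin 2) ℂ :=
  tensorOp fun q => if q ∈ S then hadamard else 1

/-! Both directions rest on two descriptions of the data, one linear over the field with two
elements and one by permutations of darts.

Linear part. Bit strings on the edges form a vector space over `ZMod 2`. The vertex stabilizers make
a code state invariant under translation by cuts. The face stabilizers make it vanish outside the
kernel of the face incidence matrix. Vertex and face incidences are orthogonal, and by Euler's
formula their ranks add up to the number of edges, so this kernel is exactly the cut space
(`PlaneMultigraph.face_mulVec_eq_zero_iff`). Hence code states are the normalized constant functions
on the cut space (`isCodeState_iff`). A cut is determined by its arbitrary values on a spanning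
forest `T`. Hadamard gates outside `T` therefore turn the superposition of cuts into a state of
constant modulus with a quadratic sign. The sign has one term for each pair `a ∉ T`, `t ∈ T` such
that `a` lies in the fundamental cut of `t`, and this is the graph state of the fundamental graph
(`hadamardsOn_isCodeState`).

Circle graphs. Put `σ = rot * flipOn T`; it walks around the forest and meets both darts of every
edge. The positions of the darts along this tour give a chord for each edge. The chords of `a` and
`b` cross exactly if multiplying `σ` by the transposition of the darts of `a` separates the darts of
`b` (`IsTour.cross_iff`). For `a ∈ T` the cycles of the product are the components of `T \ {a}`. For
`a ∉ T` they are the components of `Tᶜ \ {a}` in the dual, where `Tᶜ` is acyclic (`dual_acyclic`).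
So two edges of `T`, or two edges outside `T`, never cross, and mixed pairs cross as in the
fundamental graph.

Converse. For a bipartite circle graph with colour class `T`, let `σ` be the rotation of all chord
ends around the circle. Take the cycles of `σ * flipOn T` as vertices and those of `σ * flipOn Tᶜ`
as faces. Chords of one colour do not cross, so `T` and `Tᶜ` are spanning trees of the primal and
the dual. Counting their edges gives Euler's formula (`IsTour.planeMultigraph`), and the crossing
criterion identifies the fundamental graph with the given one. -/

/-! ### Reachability along edges -/

section Reach

variable {V W E : Type*} {vert : E × Bool → V} {S T : Set E}

theorem EdgeReach.refl (x : V) : EdgeReach vert S x x := Relation.EqvGen.refl x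

theorem EdgeReach.symm {x y : V} (h : EdgeReach vert S x y) : EdgeReach vert S y x :=
  Relation.EqvGen.symm _ _ h

theorem EdgeReach.trans {x y z : V} (h : EdgeReach vert S x y) (h' : EdgeReach vert S y z) :
    EdgeReach vert S x z :=
  Relation.EqvGen.trans _ _ _ h h'

theorem EdgeReach.of_dart {d : E × Bool} (h : d.1 ∈ S) :
    EdgeReach vert S (vert d) (vert (revDart d)) :=
  Relation.EqvGen.rel _ _ ⟨d, h, rfl, rfl⟩

theorem EdgeReach.of_mem {e : E} (h : e ∈ S) (b b' : Bool) :
    EdgeReach vert S (vert (e, b)) (vert (e, b')) := by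
  by_cases hb : b' = b
  · rw [hb]; exact .refl _
  · have : (e, b') = revDart (e, b) := by
      cases b <;> cases b' <;> simp_all [revDart]
    rw [this]
    exact .of_dart h

/-- Reachability is the least equivalence relation that joins the ends of every edge of `S`; by
symmetry one orientation of each edge suffices. -/
theorem EdgeReach.lift {r : V → V → Prop} (hr : Equivalence r)
    (h : ∀ e ∈ S, r (vert (e, false)) (vert (e, true))) {x y : V} (hxy : EdgeReach vert S x y) :
    r x y := by
  induction hxy with
  | rel x y hxy =>
    obtain ⟨⟨e, b⟩, he, rfl, rfl⟩ := hxy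
    cases b
    · exact h e he
    · exact hr.symm (h e he)
  | refl x => exact hr.refl x
  | symm x y _ ih => exact hr.symm ih
  | trans x y z _ _ ih₁ ih₂ => exact hr.trans ih₁ ih₂

theorem EdgeReach.equivalence : Equivalence (EdgeReach vert S) :=
  ⟨.refl, .symm, .trans⟩

theorem EdgeReach.mono (h : S ⊆ T) {x y : V} (hxy : EdgeReach vert S x y) :
    EdgeReach vert T x y :=
  hxy.lift EdgeReach.equivalence fun _ he => .of_mem (h he) _ _

theorem EdgeReach.map {vert' : E × Bool → W} {g : V → W} (hg : ∀ d, g (vert d) = vert' d)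
    {x y : V} (hxy : EdgeReach vert S x y) : EdgeReach vert' S (g x) (g y) := by
  refine hxy.lift (r := fun x y => EdgeReach vert' S (g x) (g y))
    ⟨fun _ => .refl _, .symm, .trans⟩ fun e he => ?_
  rw [hg, hg]
  exact .of_mem he _ _

theorem EdgeReach.eq_of_empty {x y : V} (h : EdgeReach vert ∅ x y) : x = y :=
  h.lift eq_equivalence (by simp)

theorem EdgeReach.apply_eq {α : Type*} {c : V → α}
    (hc : ∀ e ∈ S, c (vert (e, false)) = c (vert (e, true))) {x y : V}
    (h : EdgeReach vert S x y) : c x = c y :=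
  h.lift (r := fun x y => c x = c y) ⟨fun _ => rfl, Eq.symm, Eq.trans⟩ hc

/-- `x` is joined by edges of `S` to an end of the edge `t`. -/
def ReachesEnd (vert : E × Bool → V) (S : Set E) (t : E) (x : V) : Prop :=
  EdgeReach vert S (vert (t, false)) x ∨ EdgeReach vert S (vert (t, true)) x

/-- A new edge merges the classes of its two ends and changes nothing else. The form matches
`sameCycle_mul_swap_iff`, so that components and cycles can be compared edge by edge. -/
theorem edgeReach_insert {t : E} {x y : V} :
    EdgeReach vert (insert t S) x y ↔
      EdgeReach vert S x y ∨ (ReachesEnd vert S t x ∧ ReachesEnd vert S t y) := by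
  constructor
  · intro h
    refine h.lift (r := fun x y => EdgeReach vert S x y ∨
      (ReachesEnd vert S t x ∧ ReachesEnd vert S t y)) ⟨fun _ => .inl (.refl _), ?_, ?_⟩ ?_
    · rintro x y (h | h)
      · exact .inl h.symm
      · exact .inr h.symm
    · rintro x y z (h | h) (h' | h')
      · exact .inl (h.trans h')
      · exact .inr ⟨h'.1.imp (·.trans h.symm) (·.trans h.symm), h'.2⟩
      · exact .inr ⟨h.1, h.2.imp (·.trans h') (·.trans h')⟩
      · exact .inr ⟨h.1, h'.2⟩
    · rintro e (rfl | he)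
      · exact .inr ⟨.inl (.refl _), .inr (.refl _)⟩
      · exact .inl (.of_mem he _ _)
  · have key : ∀ z, ReachesEnd vert S t z →
        EdgeReach vert (insert t S) (vert (t, false)) z := by
      rintro z (h | h)
      · exact h.mono (Set.subset_insert _ _)
      · exact (EdgeReach.of_mem (Set.mem_insert t S) false true).trans
          (h.mono (Set.subset_insert _ _))
    rintro (h | ⟨hx, hy⟩)
    · exact h.mono (Set.subset_insert _ _)
    · exact (key x hx).symm.trans (key y hy)

/-- `T` is acyclic and joins any two vertices that are joined by edges. -/
def IsForestOf (vert : E × Bool → V) (T : Set E) : Prop :=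
  (∀ x y, EdgeReach vert Set.univ x y → EdgeReach vert T x y) ∧
    ∀ e ∈ T, ¬ EdgeReach vert (T \ {e}) (vert (e, false)) (vert (e, true))

/-- A minimal edge set with the full reachability relation is acyclic: an edge whose ends stay
joined without it could be dropped. -/
theorem exists_isForestOf [Finite E] (vert : E × Bool → V) : ∃ T : Set E, IsForestOf vert T := by
  obtain ⟨T, hT⟩ := Set.Finite.exists_minimal (α := Set E)
    (s := {T | ∀ x y, EdgeReach vert Set.univ x y → EdgeReach vert T x y})
    (Set.toFinite _) ⟨Set.univ, fun _ _ h => h⟩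
  refine ⟨T, hT.1, fun e he h => ?_⟩
  have h2 : T \ {e} ∈ {T | ∀ x y, EdgeReach vert Set.univ x y → EdgeReach vert T x y} := by
    intro x y hxy
    refine (hT.1 x y hxy).lift EdgeReach.equivalence fun e' he' => ?_
    by_cases hee : e' = e
    · rw [hee]; exact h
    · exact .of_mem (S := T \ {e}) ⟨he', hee⟩ _ _
  exact (hT.2 h2 Set.sdiff_subset he).2 rfl

end Reach

/-! ### Coboundaries over the field with two elements -/

section Coboundary

open Module

variable {V E : Type*} (vert : E × Bool → V)

/-- The coboundary over the field with two elements. -/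
def coboundary : (V → ZMod 2) →ₗ[ZMod 2] (E → ZMod 2) where
  toFun c e := c (vert (e, false)) + c (vert (e, true))
  map_add' c c' := by ext e; simp only [Pi.add_apply]; ring
  map_smul' k c := by ext e; simp only [Pi.smul_apply, smul_eq_mul, RingHom.id_apply]; ring

@[simp]
theorem coboundary_apply (c : V → ZMod 2) (e : E) :
    coboundary vert c e = c (vert (e, false)) + c (vert (e, true)) := rfl

theorem coboundary_apply_eq_zero_iff {c : V → ZMod 2} {e : E} :
    coboundary vert c e = 0 ↔ c (vert (e, false)) = c (vert (e, true)) :=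
  CharTwo.add_eq_zero

/-- The number of ends of each edge at each vertex, modulo two. -/
noncomputable def incidence : Matrix V E (ZMod 2) :=
  Matrix.of fun x e => (Set.ncard {b : Bool | vert (e, b) = x} : ZMod 2)

open scoped Classical in
theorem ncard_ends (x : V) (e : E) : Set.ncard {b : Bool | vert (e, b) = x} =
    (if vert (e, false) = x then 1 else 0) + if vert (e, true) = x then 1 else 0 := by
  rw [show {b : Bool | vert (e, b) = x} =
    ((Finset.univ.filter fun b => vert (e, b) = x : Finset Bool) : Set Bool) by simp,
    Set.ncard_coe_finset, Finset.card_filter, Fintype.sum_bool, add_comm]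

open scoped Classical in
theorem incidence_apply (x : V) (e : E) : incidence vert x e =
    (if vert (e, false) = x then 1 else 0) + if vert (e, true) = x then 1 else 0 := by
  simp [incidence, ncard_ends]

theorem row_incidence_mem (x : V) : incidence vert x ∈ (coboundary vert).range := by
  classical
  refine ⟨Pi.single x 1, ?_⟩
  ext e
  simp [incidence_apply, Pi.single_apply]

theorem transpose_incidence_mulVec [Fintype V] (c : V → ZMod 2) :
    (incidence vert).transpose.mulVec c = coboundary vert c := by
  classical
  ext e
  simp [Matrix.mulVec, dotProduct, incidence_apply, add_mul, Finset.sum_add_distrib]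

/-- The kernel consists of the functions that are constant on components, that is, of the functions
on the set of components. -/
theorem finrank_ker_coboundary [Fintype V] :
    finrank (ZMod 2) (coboundary vert).ker = numComponents vert := by
  classical
  have h1 : (LinearMap.funLeft (ZMod 2) (ZMod 2)
      (Quot.mk (EdgeReach vert Set.univ))).range = (coboundary vert).ker := by
    ext c
    simp only [LinearMap.mem_range, LinearMap.mem_ker]
    constructor
    · rintro ⟨c, rfl⟩
      ext e
      rw [Pi.zero_apply, coboundary_apply_eq_zero_iff]
      exact congrArg c (Quot.sound (.of_mem (Set.mem_univ e) _ _))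
    · intro hc
      refine ⟨Quot.lift c fun x y h => h.apply_eq fun e _ => ?_, rfl⟩
      rw [← coboundary_apply_eq_zero_iff, hc]; rfl
  have : Fintype (Quot (EdgeReach vert Set.univ)) := Fintype.ofFinite _
  rw [← h1, LinearMap.finrank_range_of_inj
    (LinearMap.funLeft_injective_of_surjective _ _ _ Quot.mk_surjective), finrank_fintype_fun_eq_card,
    numComponents, Nat.card_eq_fintype_card]

theorem finrank_range_coboundary [Fintype V] :
    finrank (ZMod 2) (coboundary vert).range + numComponents vert = Nat.card V := by
  rw [← finrank_ker_coboundary, LinearMap.finrank_range_add_finrank_ker,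
    finrank_fintype_fun_eq_card, Nat.card_eq_fintype_card]

theorem rank_incidence [Fintype V] [Fintype E] :
    (incidence vert).rank + numComponents vert = Nat.card V := by
  rw [← Matrix.rank_transpose, ← finrank_range_coboundary, Matrix.rank,
    show (incidence vert).transpose.mulVecLin = coboundary vert from
      LinearMap.ext (transpose_incidence_mulVec vert)]

theorem numComponents_eq_one [Nonempty V] (h : ∀ x y, EdgeReach vert Set.univ x y) :
    numComponents vert = 1 := by
  have : Subsingleton (Quot (EdgeReach vert Set.univ)) :=
    ⟨by rintro ⟨x⟩ ⟨y⟩; exact Quot.sound (h x y)⟩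
  have : Nonempty (Quot (EdgeReach vert Set.univ)) := ⟨Quot.mk _ (Classical.arbitrary V)⟩
  exact Nat.card_of_subsingleton (Classical.arbitrary _)

end Coboundary

/-! ### Fundamental cuts of a spanning forest -/

section Cuts

open Module

variable {V E : Type*} {vert : E × Bool → V} {T : Set E}

/-- The edges outside the forest whose ends are separated by the removal of `t`, together with
`t`. -/
noncomputable def fundamentalCut (vert : E × Bool → V) (T : Set E) (t : E) : E → ZMod 2 := by
  classical
  exact fun e =>
    if EdgeReach vert (T \ {t}) (vert (e, false)) (vert (e, true)) then 0 else 1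

theorem fundamentalCut_eq_zero_iff {t e : E} : fundamentalCut vert T t e = 0 ↔
    EdgeReach vert (T \ {t}) (vert (e, false)) (vert (e, true)) := by
  simp [fundamentalCut]

theorem fundamentalCut_of_ne {t e : E} (he : e ∈ T) (h : e ≠ t) :
    fundamentalCut vert T t e = 0 :=
  fundamentalCut_eq_zero_iff.2 (.of_mem (S := T \ {t}) ⟨he, h⟩ _ _)

theorem IsForestOf.fundamentalCut_self (hT : IsForestOf vert T) {t : E} (ht : t ∈ T) :
    fundamentalCut vert T t t = 1 := by
  have := hT.2 t ht
  simp [fundamentalCut, this]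

/-- The cut is the coboundary of the indicator of everything not reachable from the first end of `t`
in `T \ {t}`. Since `T` joins the ends of every edge, an edge with ends separated in `T \ {t}` has
them on opposite sides of `t`. -/
theorem IsForestOf.fundamentalCut_mem (hT : IsForestOf vert T) {t : E} (ht : t ∈ T) :
    fundamentalCut vert T t ∈ (coboundary vert).range := by
  classical
  refine ⟨fun x => if EdgeReach vert (T \ {t}) (vert (t, false)) x then 0 else 1, ?_⟩
  ext e
  have h1 := edgeReach_insert.1 (show EdgeReach vert (insert t (T \ {t})) (vert (e, false))
    (vert (e, true)) by
      rw [Set.insert_sdiff_singleton, Set.insert_eq_of_mem ht]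
      exact hT.1 _ _ (.of_mem (Set.mem_univ e) _ _))
  have h2 := hT.2 t ht
  simp only [coboundary_apply, fundamentalCut]
  have two : (1 : ZMod 2) + 1 = 0 := rfl
  by_cases h : EdgeReach vert (T \ {t}) (vert (e, false)) (vert (e, true))
  · have : EdgeReach vert (T \ {t}) (vert (t, false)) (vert (e, false)) ↔
        EdgeReach vert (T \ {t}) (vert (t, false)) (vert (e, true)) :=
      ⟨fun h' => h'.trans h, fun h' => h'.trans h.symm⟩
    rw [if_pos h]
    split_ifs <;> simp_all
  · rw [if_neg h]
    obtain ⟨h3 | h3, h4 | h4⟩ := h1.resolve_left h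
    · exact absurd (h3.symm.trans h4) h
    · rw [if_pos h3, if_neg fun h5 => h2 (h5.trans h4.symm), zero_add]
    · rw [if_pos h4, if_neg fun h5 => h2 (h5.trans h3.symm), add_zero]
    · exact absurd (h3.symm.trans h4) h

/-- A potential that does not change along the edges of `T` is constant on each component, because
`T` spans. -/
theorem IsForestOf.eq_zero_of_restrict (hT : IsForestOf vert T) {x : E → ZMod 2}
    (hx : x ∈ (coboundary vert).range) (h : ∀ t ∈ T, x t = 0) : x = 0 := by
  obtain ⟨c, rfl⟩ := hx
  ext e
  rw [Pi.zero_apply, coboundary_apply_eq_zero_iff]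
  exact (hT.1 _ _ (.of_mem (Set.mem_univ e) false true)).apply_eq fun t ht =>
    (coboundary_apply_eq_zero_iff vert).1 (h t ht)

open scoped Classical in
/-- The cut with prescribed values on the forest. -/
noncomputable def cutWith [Fintype E] (vert : E × Bool → V) (T : Set E) (y : E → ZMod 2) :
    E → ZMod 2 :=
  ∑ t, if t ∈ T then y t • fundamentalCut vert T t else 0

theorem IsForestOf.cutWith_mem [Fintype E] (hT : IsForestOf vert T) (y : E → ZMod 2) :
    cutWith vert T y ∈ (coboundary vert).range := by
  refine Submodule.sum_mem _ fun t _ => ?_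
  split_ifs with ht
  · exact Submodule.smul_mem _ _ (hT.fundamentalCut_mem ht)
  · exact Submodule.zero_mem _

open scoped Classical in
theorem cutWith_apply [Fintype E] (y : E → ZMod 2) (e : E) :
    cutWith vert T y e = ∑ t, if t ∈ T then y t * fundamentalCut vert T t e else 0 := by
  simp only [cutWith, Finset.sum_apply]
  refine Finset.sum_congr rfl fun t _ => ?_
  split_ifs <;> simp

theorem IsForestOf.cutWith_of_mem [Fintype E] (hT : IsForestOf vert T) (y : E → ZMod 2) {e : E}
    (he : e ∈ T) : cutWith vert T y e = y e := by
  classical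
  rw [cutWith_apply, Finset.sum_eq_single e]
  · rw [if_pos he, hT.fundamentalCut_self he, mul_one]
  · intro t _ h
    rw [fundamentalCut_of_ne he h.symm, mul_zero, ite_self]
  · simp

theorem IsForestOf.eq_cutWith [Fintype E] (hT : IsForestOf vert T) {x y : E → ZMod 2}
    (hx : x ∈ (coboundary vert).range) (h : ∀ t ∈ T, x t = y t) : x = cutWith vert T y := by
  rw [← sub_eq_zero]
  refine hT.eq_zero_of_restrict (Submodule.sub_mem _ hx (hT.cutWith_mem y)) fun t ht => ?_
  rw [Pi.sub_apply, hT.cutWith_of_mem y ht, h t ht, sub_self]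

theorem IsForestOf.finrank_range [Fintype E] (hT : IsForestOf vert T) :
    finrank (ZMod 2) (coboundary vert).range = Nat.card T := by
  classical
  have : Fintype T := Fintype.ofFinite _
  rw [Nat.card_eq_fintype_card, ← finrank_fintype_fun_eq_card (R := ZMod 2)]
  refine LinearEquiv.finrank_eq (LinearEquiv.ofBijective
    ((LinearMap.funLeft (ZMod 2) (ZMod 2) ((↑) : T → E)).comp (coboundary vert).range.subtype)
    ⟨?_, fun y => ?_⟩)
  · rw [← LinearMap.ker_eq_bot, LinearMap.ker_eq_bot']
    rintro ⟨x, hx⟩ h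
    ext1
    exact hT.eq_zero_of_restrict hx fun t ht => congrFun h ⟨t, ht⟩
  · refine ⟨⟨_, hT.cutWith_mem fun e => if h : e ∈ T then y ⟨e, h⟩ else 0⟩, ?_⟩
    ext t
    refine (hT.cutWith_of_mem _ t.2).trans ?_
    simp

theorem IsForestOf.card_add_numComponents [Fintype V] [Fintype E] (hT : IsForestOf vert T) :
    Nat.card T + numComponents vert = Nat.card V := by
  rw [← hT.finrank_range, finrank_range_coboundary]

end Cuts

/-! ### Cycles of a permutation times a transposition -/

section SameCycle

open Equiv Equiv.Perm

variable {α : Type*} {σ : Perm α}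

theorem Equiv.Perm.SameCycle.lift {r : α → α → Prop} (hr : Equivalence r)
    (h : ∀ d, r d (σ d)) {x y : α} (hxy : σ.SameCycle x y) : r x y := by
  have key : ∀ n : ℕ, ∀ d, r d ((σ ^ n) d) := by
    intro n
    induction n with
    | zero => exact hr.refl
    | succ n ih => intro d; rw [pow_succ', mul_apply]; exact hr.trans (ih d) (h _)
  obtain ⟨k | k, rfl⟩ := hxy
  · exact key k x
  · have := key (k + 1) ((σ ^ (Int.negSucc k)) x)
    rw [zpow_negSucc, ← mul_apply, mul_inv_cancel, one_apply] at this
    rw [zpow_negSucc]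
    exact hr.symm this

theorem sameCycle_apply_self (σ : Perm α) (d : α) : σ.SameCycle d (σ d) := ⟨1, by simp⟩

/-- `u` lies on the cycle of `x` or on the cycle of `y`. -/
def OnCycles (σ : Perm α) (x y u : α) : Prop := σ.SameCycle x u ∨ σ.SameCycle y u

variable [DecidableEq α]

/-- The product differs from `σ` only at `x` and `y`, so an old cycle can break only there. No
assumption on `x` and `y` is needed for this direction. -/
theorem Equiv.Perm.SameCycle.mul_swap {x y u v : α} (h : σ.SameCycle u v) :
    (σ * swap x y).SameCycle u v ∨
      (OnCycles (σ * swap x y) x y u ∧ OnCycles (σ * swap x y) x y v) := by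
  refine h.lift (r := fun u v => (σ * swap x y).SameCycle u v ∨
      (OnCycles (σ * swap x y) x y u ∧ OnCycles (σ * swap x y) x y v))
    ⟨fun _ => .inl (.refl _ _), ?_, ?_⟩ fun d => ?_
  · rintro u v (h | h)
    · exact .inl h.symm
    · exact .inr h.symm
  · rintro u v w (h | h) (h' | h')
    · exact .inl (h.trans h')
    · exact .inr ⟨h'.1.imp (·.trans h.symm) (·.trans h.symm), h'.2⟩
    · exact .inr ⟨h.1, h.2.imp (·.trans h') (·.trans h')⟩
    · exact .inr ⟨h.1, h'.2⟩
  · by_cases hx : d = x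
    · subst hx
      refine .inr ⟨.inl (.refl _ _), .inr ?_⟩
      simpa using sameCycle_apply_self (σ * swap d y) y
    · by_cases hy : d = y
      · subst hy
        refine .inr ⟨.inr (.refl _ _), .inl ?_⟩
        simpa using sameCycle_apply_self (σ * swap x d) x
      · left
        have := sameCycle_apply_self (σ * swap x y) d
        rwa [mul_apply, swap_apply_of_ne_of_ne hx hy] at this

/-- The product sends `y` to `σ x` and then follows the old cycle of `x`, which avoids `y`, until it
returns to `x`. -/
theorem sameCycle_mul_swap_self [Finite α] {x y : α} (h : ¬ σ.SameCycle x y) :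
    (σ * swap x y).SameCycle y x := by
  have key : ∀ n : ℕ, (σ * swap x y).SameCycle y ((σ ^ (n + 1)) x) := by
    intro n
    induction n with
    | zero => simpa using sameCycle_apply_self (σ * swap x y) y
    | succ n ih =>
      rw [pow_succ', mul_apply]
      by_cases hx : (σ ^ (n + 1)) x = x
      · rw [hx]
        simpa using sameCycle_apply_self (σ * swap x y) y
      · have hy : (σ ^ (n + 1)) x ≠ y := fun h' => h ⟨(n + 1 : ℕ), by rw [zpow_natCast]; exact h'⟩
        refine ih.trans ?_
        have := sameCycle_apply_self (σ * swap x y) ((σ ^ (n + 1)) x)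
        rwa [mul_apply, swap_apply_of_ne_of_ne hx hy] at this
  have := key (orderOf σ - 1)
  rwa [Nat.sub_add_cancel (orderOf_pos σ), pow_orderOf_eq_one] at this

theorem sameCycle_mul_swap_iff [Finite α] {x y u v : α} (h : ¬ σ.SameCycle x y) :
    (σ * swap x y).SameCycle u v ↔
      σ.SameCycle u v ∨ (OnCycles σ x y u ∧ OnCycles σ x y v) := by
  have hxy := sameCycle_mul_swap_self h
  have back : ∀ {u v}, σ.SameCycle u v → (σ * swap x y).SameCycle u v := by
    intro u v huv
    have on : ∀ {w}, OnCycles (σ * swap x y) x y w → (σ * swap x y).SameCycle x w :=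
      fun hw => hw.elim id fun hw => hxy.symm.trans hw
    rcases huv.mul_swap (x := x) (y := y) with h' | ⟨hu, hv⟩
    · exact h'
    · exact (on hu).symm.trans (on hv)
  constructor
  · intro huv
    -- The transposition is an involution, so the general direction applies to the product itself.
    simpa [mul_assoc] using huv.mul_swap (x := x) (y := y)
  · have on : ∀ {w}, OnCycles σ x y w → (σ * swap x y).SameCycle x w :=
      fun hw => hw.elim back fun hw => hxy.symm.trans (back hw)
    rintro (huv | ⟨hu, hv⟩)
    · exact back huv
    · exact (on hu).symm.trans (on hv)

end SameCycle

/-! ### Reversing the darts of a set of edges -/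

section Flip

open Equiv Equiv.Perm

variable {E V W : Type*}

@[simp]
theorem revDart_revDart (d : E × Bool) : revDart (revDart d) = d := by simp [revDart]

@[simp]
theorem revDart_fst (d : E × Bool) : (revDart d).1 = d.1 := rfl

open scoped Classical in
/-- The permutation that exchanges the two darts of every edge of `S`. -/
noncomputable def flipOn (S : Set E) : Perm (E × Bool) where
  toFun d := if d.1 ∈ S then revDart d else d
  invFun d := if d.1 ∈ S then revDart d else d
  left_inv d := by by_cases h : d.1 ∈ S <;> simp [h]
  right_inv d := by by_cases h : d.1 ∈ S <;> simp [h]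

theorem flipOn_of_mem {S : Set E} {d : E × Bool} (h : d.1 ∈ S) : flipOn S d = revDart d :=
  if_pos h

theorem flipOn_of_notMem {S : Set E} {d : E × Bool} (h : d.1 ∉ S) : flipOn S d = d :=
  if_neg h

@[simp]
theorem flipOn_fst {S : Set E} (d : E × Bool) : (flipOn S d).1 = d.1 := by
  by_cases h : d.1 ∈ S
  · rw [flipOn_of_mem h, revDart_fst]
  · rw [flipOn_of_notMem h]

theorem flipOn_empty : flipOn (∅ : Set E) = 1 :=
  Equiv.ext fun d => flipOn_of_notMem (Set.notMem_empty d.1)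

theorem flipOn_mul_flipOn (S T : Set E) : flipOn S * flipOn T = flipOn (symmDiff S T) := by
  ext1 d
  rw [mul_apply]
  by_cases hT : d.1 ∈ T <;> by_cases hS : d.1 ∈ S
  · rw [flipOn_of_mem hT, flipOn_of_mem (by exact hS), flipOn_of_notMem, revDart_revDart]
    simp [Set.mem_symmDiff, hT, hS]
  · rw [flipOn_of_mem hT, flipOn_of_notMem (by exact hS), flipOn_of_mem]
    simp [Set.mem_symmDiff, hT, hS]
  · rw [flipOn_of_notMem hT, flipOn_of_mem hS, flipOn_of_mem]
    simp [Set.mem_symmDiff, hT, hS]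
  · rw [flipOn_of_notMem hT, flipOn_of_notMem hS, flipOn_of_notMem]
    simp [Set.mem_symmDiff, hT, hS]

theorem flipOn_singleton [DecidableEq E] (t : E) :
    flipOn {t} = swap (t, false) (t, true) := by
  ext1 ⟨e, b⟩
  by_cases h : e = t
  · subst h
    rw [flipOn_of_mem (Set.mem_singleton e)]
    cases b <;> simp [revDart]
  · rw [flipOn_of_notMem (by simpa using h), swap_apply_of_ne_of_ne] <;> simp [h]

theorem flipOn_mul_swap_of_notMem [DecidableEq E] {S : Set E} {t : E} (h : t ∉ S) :
    flipOn S * swap (t, false) (t, true) = flipOn (insert t S) := by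
  rw [← flipOn_singleton, flipOn_mul_flipOn]
  congr 1
  ext e
  simp only [Set.mem_symmDiff, Set.mem_singleton_iff, Set.mem_insert_iff]
  by_cases he : e = t <;> simp_all

theorem flipOn_mul_swap_of_mem [DecidableEq E] {S : Set E} {t : E} (h : t ∈ S) :
    flipOn S * swap (t, false) (t, true) = flipOn (S \ {t}) := by
  rw [← flipOn_singleton, flipOn_mul_flipOn]
  congr 1
  ext e
  simp only [Set.mem_symmDiff, Set.mem_singleton_iff, Set.mem_sdiff]
  by_cases he : e = t <;> simp_all

theorem flipOn_mul_univ (S : Set E) : flipOn S * flipOn Set.univ = flipOn Sᶜ := by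
  rw [flipOn_mul_flipOn]
  congr 1
  ext e
  simp [Set.mem_symmDiff]

theorem flipOn_mul_of_subset {S T : Set E} (h : S ⊆ T) :
    flipOn T * flipOn S = flipOn (T \ S) := by
  rw [flipOn_mul_flipOn]
  congr 1
  ext e
  have := @h e
  simp only [Set.mem_symmDiff, Set.mem_sdiff]
  tauto

theorem flipOn_univ_apply (d : E × Bool) : flipOn Set.univ d = revDart d :=
  flipOn_of_mem (Set.mem_univ d.1)

/-- Each further edge multiplies the permutation by a transposition; as long as this transposition
joins two different cycles, cycles merge exactly as components do. The hypothesis may be given on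
either side: acyclicity for forests, separated darts for noncrossing chords. -/
theorem sameCycle_mul_flipOn_iff [Finite E] {π : Perm (E × Bool)} {vert : E × Bool → V}
    (hπ : ∀ d d', π.SameCycle d d' ↔ vert d = vert d') {T : Set E}
    (hT : ∀ S ⊆ T, ∀ t ∈ T, t ∉ S →
      ¬ EdgeReach vert S (vert (t, false)) (vert (t, true)) ∨
        ¬ (π * flipOn S).SameCycle (t, false) (t, true)) (d d' : E × Bool) :
    (π * flipOn T).SameCycle d d' ↔ EdgeReach vert T (vert d) (vert d') := by
  classical
  induction T, T.toFinite using Set.Finite.induction_on generalizing d d' with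
  | empty =>
    rw [flipOn_empty, mul_one, hπ]
    exact ⟨fun h => h ▸ .refl _, EdgeReach.eq_of_empty⟩
  | @insert t S htS _ ih =>
    replace ih := ih fun S' hS' t' ht' =>
      hT S' (hS'.trans (Set.subset_insert t S)) t' (Set.mem_insert_of_mem t ht')
    have h : ¬ (π * flipOn S).SameCycle (t, false) (t, true) := by
      rcases hT S (Set.subset_insert t S) t (Set.mem_insert t S) htS with h | h
      · rwa [ih]
      · exact h
    rw [← flipOn_mul_swap_of_notMem htS, ← mul_assoc, sameCycle_mul_swap_iff h, edgeReach_insert]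
    simp only [OnCycles, ReachesEnd, ih]

theorem sameCycle_mul_flipOn_iff_of_acyclic [Finite E] {π : Perm (E × Bool)}
    {vert : E × Bool → V} (hπ : ∀ d d', π.SameCycle d d' ↔ vert d = vert d') {T S : Set E}
    (hT : ∀ t ∈ T, ¬ EdgeReach vert (T \ {t}) (vert (t, false)) (vert (t, true)))
    (hS : S ⊆ T) (d d' : E × Bool) :
    (π * flipOn S).SameCycle d d' ↔ EdgeReach vert S (vert d) (vert d') :=
  sameCycle_mul_flipOn_iff hπ (fun _ hS' t ht htS => .inl fun h => hT t (hS ht)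
    (h.mono (T := T \ {t}) fun _ he => ⟨hS (hS' he), fun h => htS (h ▸ he)⟩)) d d'

end Flip

/-! ### Crossing chords -/

section Cross

open Equiv Equiv.Perm

variable {E R : Type*} [CommRing R] [LinearOrder R]

/-- The chords of `a` and `b` cross: exactly one end of `b` lies between the ends of `a`. -/
def Cross (pos : E × Bool → R) (a b : E) : Prop :=
  (pos (b, false) - pos (a, false)) * (pos (b, false) - pos (a, true)) *
    ((pos (b, true) - pos (a, false)) * (pos (b, true) - pos (a, true))) < 0

theorem cross_comm (pos : E × Bool → R) (a b : E) : Cross pos a b ↔ Cross pos b a := by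
  simp only [Cross]
  rw [show (pos (b, false) - pos (a, false)) * (pos (b, false) - pos (a, true)) *
    ((pos (b, true) - pos (a, false)) * (pos (b, true) - pos (a, true))) =
    (pos (a, false) - pos (b, false)) * (pos (a, false) - pos (b, true)) *
    ((pos (a, true) - pos (b, false)) * (pos (a, true) - pos (b, true))) by ring]

variable [IsStrictOrderedRing R]

/-- The positions strictly after the first end of `a`, up to the second end. -/
def Between (pos : E × Bool → R) (a : E) (d : E × Bool) : Prop :=
  min (pos (a, false)) (pos (a, true)) < pos d ∧ pos d ≤ max (pos (a, false)) (pos (a, true))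

theorem between_iff {pos : E × Bool → R} (hpos : Function.Injective pos) {a : E} {d : E × Bool}
    (h : d.1 ≠ a) :
    Between pos a d ↔ (pos d - pos (a, false)) * (pos d - pos (a, true)) < 0 := by
  have h0 : pos d ≠ pos (a, false) := fun h' => h (by rw [hpos h'])
  have h1 : pos d ≠ pos (a, true) := fun h' => h (by rw [hpos h'])
  rw [mul_neg_iff, Between, min_lt_iff, le_max_iff, sub_pos, sub_pos, sub_neg, sub_neg]
  rcases lt_or_gt_of_ne h0 with h0 | h0 <;> rcases lt_or_gt_of_ne h1 with h1 | h1 <;>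
    simp [h0, h1, h0.le, h1.le, h0.not_gt, h1.not_gt, h0.not_ge, h1.not_ge]

theorem mul_ne_zero_of_ne {pos : E × Bool → R} (hpos : Function.Injective pos) {a : E}
    {d : E × Bool} (h : d.1 ≠ a) :
    (pos d - pos (a, false)) * (pos d - pos (a, true)) ≠ 0 :=
  mul_ne_zero (sub_ne_zero.2 fun h' => h (by rw [hpos h']))
    (sub_ne_zero.2 fun h' => h (by rw [hpos h']))

theorem cross_iff {pos : E × Bool → R} (hpos : Function.Injective pos) {a b : E} (h : b ≠ a) :
    Cross pos a b ↔ ¬ (Between pos a (b, false) ↔ Between pos a (b, true)) := by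
  rw [between_iff hpos h, between_iff hpos h, Cross, mul_neg_iff]
  have h0 := mul_ne_zero_of_ne hpos (d := (b, false)) h
  have h1 := mul_ne_zero_of_ne hpos (d := (b, true)) h
  rcases lt_or_gt_of_ne h0 with h0 | h0 <;> rcases lt_or_gt_of_ne h1 with h1 | h1 <;>
    simp [h0, h1, h0.not_gt, h1.not_gt]

/-- Positions of the darts for which `σ` moves every dart to the next position, or from the last
to the first position of its cycle. -/
def IsTour (σ : Perm (E × Bool)) (pos : E × Bool → ℤ) : Prop :=
  Function.Injective pos ∧ ∀ d, pos (σ d) = pos d + 1 ∨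
    ∀ d', σ.SameCycle d d' → pos (σ d) ≤ pos d' ∧ pos d' ≤ pos d

variable {σ : Perm (E × Bool)} {pos : E × Bool → ℤ}

/-- The part of the cycle of `a` between the ends of `a`. -/
def Arc (σ : Perm (E × Bool)) (pos : E × Bool → ℤ) (a : E) (d : E × Bool) : Prop :=
  σ.SameCycle (a, false) d ∧ Between pos a d

/-- A step of the tour enters or leaves the arc only at an end of `a`. The jump from the last to the
first position of the cycle of `a` stays outside, since both ends of `a` lie between these
positions. -/
theorem IsTour.arc_apply (h : IsTour σ pos) {a : E} (ha : σ.SameCycle (a, false) (a, true))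
    {d : E × Bool} (hd : d.1 ≠ a) : Arc σ pos a (σ d) ↔ Arc σ pos a d := by
  have h0 : pos d ≠ pos (a, false) := fun h' => hd (by rw [h.1 h'])
  have h1 : pos d ≠ pos (a, true) := fun h' => hd (by rw [h.1 h'])
  simp only [Arc, Between, sameCycle_apply_right]
  refine and_congr_right fun hc => ?_
  rcases h.2 d with h2 | h2
  · omega
  · have h3 := h2 _ hc.symm
    have h4 := h2 _ (hc.symm.trans ha)
    omega

/-- The arc is half-open: it omits the earlier end of `a` and contains the later one. Hence flipping
`a` before a step of the tour preserves membership in the arc. -/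
theorem IsTour.arc_apply_end (h : IsTour σ pos) {a : E} (ha : σ.SameCycle (a, false) (a, true))
    (b : Bool) : Arc σ pos a (σ (a, b)) ↔ Arc σ pos a (a, !b) := by
  have hne : pos (a, false) ≠ pos (a, true) := fun h' => by simpa using h.1 h'
  have hc : ∀ b, σ.SameCycle (a, false) (a, b) := fun b => by
    cases b
    · exact .refl _ _
    · exact ha
  simp only [Arc, Between, sameCycle_apply_right, hc, true_and]
  rcases h.2 (a, b) with h2 | h2
  · cases b <;> simp only [Bool.not_true, Bool.not_false] <;> omega
  · have h3 := h2 _ (hc b).symm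
    have h4 := h2 _ ((hc b).symm.trans ha)
    cases b <;> simp only [Bool.not_true, Bool.not_false] <;> omega

theorem IsTour.not_arc_iff (h : IsTour σ pos) {a : E} (ha : σ.SameCycle (a, false) (a, true)) :
    ¬ (Arc σ pos a (a, false) ↔ Arc σ pos a (a, true)) := by
  have hne : pos (a, false) ≠ pos (a, true) := fun h' => by simpa using h.1 h'
  simp only [Arc, Between, ha, SameCycle.refl, true_and]
  omega

/-- Flipping an edge that does not cross `a` stays on one side of the arc, and flipping `a` itself
compensates the entry or exit. So the arc is a union of cycles of `σ * flipOn S`. -/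
theorem IsTour.arc_iff_of_sameCycle (h : IsTour σ pos)
    (hσ : ∀ e, σ.SameCycle (e, false) (e, true)) {S : Set E} {a : E} (ha : a ∈ S)
    (hS : ∀ b ∈ S, ¬ Cross pos a b) {u v : E × Bool} (huv : (σ * flipOn S).SameCycle u v) :
    Arc σ pos a u ↔ Arc σ pos a v := by
  refine huv.lift (r := fun u v => Arc σ pos a u ↔ Arc σ pos a v)
    ⟨fun _ => Iff.rfl, Iff.symm, Iff.trans⟩ fun d => ?_
  rw [mul_apply]
  by_cases hd : d.1 = a
  · obtain ⟨e, b⟩ := d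
    obtain rfl : e = a := hd
    rw [flipOn_of_mem ha, revDart, h.arc_apply_end (hσ e), Bool.not_not]
  · rw [h.arc_apply (hσ a) (by simpa using hd)]
    by_cases hdS : d.1 ∈ S
    · have h1 := hS _ hdS
      rw [cross_iff h.1 hd, not_not] at h1
      rw [flipOn_of_mem hdS]
      obtain ⟨e, b⟩ := d
      have h2 : σ.SameCycle (a, false) (e, false) ↔ σ.SameCycle (a, false) (e, true) :=
        ⟨fun h => h.trans (hσ e), fun h => h.trans (hσ e).symm⟩
      simp only [Arc]
      cases b
      · exact and_congr h2 h1
      · exact (and_congr h2 h1).symm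
    · rw [flipOn_of_notMem hdS]

/-- A discrete intermediate value argument: the tour rises by one at each step until its cycle is
exhausted. -/
theorem IsTour.exists_pos_eq (h : IsTour σ pos) {x y : E × Bool} (hxy : σ.SameCycle x y) :
    ∀ n : ℕ, pos x + n ≤ pos y → ∃ d, σ.SameCycle x d ∧ pos d = pos x + n := by
  intro n
  induction n with
  | zero => exact fun _ => ⟨x, .refl _ _, by simp⟩
  | succ n ih =>
    intro hn
    push_cast at hn
    obtain ⟨d, hd, hdn⟩ := ih (by omega)
    refine ⟨σ d, hd.trans (sameCycle_apply_self σ d), ?_⟩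
    rcases h.2 d with h2 | h2
    · push_cast; omega
    · have := h2 y (hd.symm.trans hxy)
      omega

theorem IsTour.arc_iff_between (h : IsTour σ pos) {a : E}
    (ha : σ.SameCycle (a, false) (a, true)) {d : E × Bool} :
    Arc σ pos a d ↔ Between pos a d := by
  refine ⟨fun h => h.2, fun hd => ⟨?_, hd⟩⟩
  obtain ⟨h1, h2⟩ := hd
  rcases le_total (pos (a, false)) (pos (a, true)) with hle | hle
  · rw [min_eq_left hle] at h1
    rw [max_eq_right hle] at h2
    obtain ⟨d', hd', hp⟩ := h.exists_pos_eq ha (pos d - pos (a, false)).toNat (by omega)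
    obtain rfl := h.1 (show pos d' = pos d by omega)
    exact hd'
  · rw [min_eq_right hle] at h1
    rw [max_eq_left hle] at h2
    obtain ⟨d', hd', hp⟩ := h.exists_pos_eq ha.symm (pos d - pos (a, true)).toNat (by omega)
    obtain rfl := h.1 (show pos d' = pos d by omega)
    exact ha.trans hd'

/-- The transposition cuts the cycle of `a` into the arc and the rest, so the darts of `b` are
separated exactly if one of them lies in the arc and the other does not. -/
theorem IsTour.cross_iff [DecidableEq E] (h : IsTour σ pos)
    (hσ : ∀ e, σ.SameCycle (e, false) (e, true)) {a b : E} (hab : b ≠ a) :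
    Cross pos a b ↔
      ¬ (σ * swap (a, false) (a, true)).SameCycle (b, false) (b, true) := by
  have key : ∀ {u v}, (σ * swap (a, false) (a, true)).SameCycle u v →
      (Arc σ pos a u ↔ Arc σ pos a v) := by
    intro u v huv
    rw [← flipOn_singleton] at huv
    refine h.arc_iff_of_sameCycle hσ (Set.mem_singleton a) ?_ huv
    rintro _ rfl
    simp [Cross]
  have h0 := h.not_arc_iff (hσ a)
  rw [_root_.cross_iff h.1 hab, ← h.arc_iff_between (hσ a), ← h.arc_iff_between (hσ a),
    not_iff_not]
  refine ⟨fun hb => ?_, key⟩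
  -- If the darts of `b` were on the cycles of different ends of `a`, these ends would agree about
  -- the arc, which they do not.
  rcases (hσ b).mul_swap (x := (a, false)) (y := (a, true)) with h1 | ⟨h1 | h1, h2 | h2⟩
  · exact h1
  · exact h1.symm.trans h2
  · exact absurd ((key h1).trans (hb.trans (key h2).symm)) h0
  · exact absurd ((key h2).trans (hb.symm.trans (key h1).symm)) h0
  · exact h1.symm.trans h2

theorem IsTour.not_sameCycle (h : IsTour σ pos)
    (hσ : ∀ e, σ.SameCycle (e, false) (e, true)) {S : Set E} {a : E} (ha : a ∈ S)
    (hS : ∀ b ∈ S, ¬ Cross pos a b) :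
    ¬ (σ * flipOn S).SameCycle (a, false) (a, true) :=
  fun h' => h.not_arc_iff (hσ a) (h.arc_iff_of_sameCycle hσ ha hS h')

end Cross

/-! ### Existence of tours -/

section Tour

open Equiv Equiv.Perm

variable {E : Type*}

/-- The index is the least exponent that takes `b` to the given element. -/
theorem exists_cycle_index {α : Type*} [Finite α] (σ : Perm α) (b : α) :
    ∃ i : α → ℕ, ∀ d, σ.SameCycle b d → (σ ^ i d) b = d ∧ i d < orderOf σ ∧
      (i (σ d) = i d + 1 ∨ ∀ d', σ.SameCycle b d' → i (σ d) ≤ i d' ∧ i d' ≤ i d) := by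
  classical
  have hex : ∀ d, σ.SameCycle b d → ∃ n, (σ ^ n) b = d := fun d hd =>
    let ⟨n, _, hn⟩ := hd.exists_pow_eq'
    ⟨n, hn⟩
  set i : α → ℕ := fun d => if h : ∃ n, (σ ^ n) b = d then Nat.find h else 0 with hi
  have hspec : ∀ d, σ.SameCycle b d → (σ ^ i d) b = d := fun d hd => by
    simp only [hi, dif_pos (hex d hd)]
    exact Nat.find_spec (hex d hd)
  have hmin : ∀ n d, (σ ^ n) b = d → i d ≤ n := fun n d hn => by
    simp only [hi, dif_pos (⟨n, hn⟩ : ∃ n, (σ ^ n) b = d)]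
    exact Nat.find_min' _ hn
  refine ⟨i, fun d hd => ⟨hspec d hd, ?_, ?_⟩⟩
  · obtain ⟨n, hn, h⟩ := hd.exists_pow_eq'
    exact (hmin n d h).trans_lt hn
  · have hd' := hd.trans (sameCycle_apply_self σ d)
    have h1 : (σ ^ (i d + 1)) b = σ d := by rw [pow_succ', mul_apply, hspec d hd]
    have h2 := hspec _ hd'
    rcases (hmin _ _ h1).eq_or_lt with h | h
    · exact .inl h
    right
    -- A positive index of `σ d` below `i d + 1` would, after cancelling one `σ`, give a smaller
    -- index for `d`. So `σ d = b`, and `i d + 1` is a period that bounds all indices of the cycle.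
    have h0 : i (σ d) = 0 := by
      by_contra hne
      obtain ⟨k, hk⟩ := Nat.exists_eq_succ_of_ne_zero hne
      rw [hk, Nat.succ_eq_add_one, pow_succ', mul_apply] at h2
      have := hmin k d (σ.injective h2)
      omega
    rw [h0, pow_zero, one_apply] at h2
    intro d' hdd'
    refine ⟨by omega, ?_⟩
    obtain ⟨n, hn⟩ := hex d' hdd'
    have hper : ∀ m, (σ ^ ((i d + 1) * m)) b = b := by
      intro m
      induction m with
      | zero => rfl
      | succ m ih => rw [Nat.mul_succ, pow_add, mul_apply, h1, ← h2, ih]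
    rw [← Nat.mod_add_div n (i d + 1), pow_add, mul_apply, hper] at hn
    have := hmin _ _ hn
    have := Nat.mod_lt n (Nat.succ_pos (i d))
    simp only [Nat.succ_eq_add_one] at this
    omega

theorem exists_isTour [Finite E] (σ : Perm (E × Bool)) : ∃ pos, IsTour σ pos := by
  classical
  have : Finite (Quotient (SameCycle.setoid σ)) := Quotient.finite _
  obtain ⟨idx, hidx⟩ : ∃ idx : Quotient (SameCycle.setoid σ) → ℕ, Function.Injective idx :=
    ⟨fun q => Finite.equivFin _ q, Fin.val_injective.comp (Equiv.injective _)⟩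
  choose i hi using exists_cycle_index σ
  let q : E × Bool → Quotient (SameCycle.setoid σ) := Quotient.mk _
  have hq : ∀ d, σ.SameCycle (q d).out d := fun d => Quotient.exact (Quotient.out_eq (q d))
  have hqq : ∀ d d', σ.SameCycle d d' → q d' = q d := fun d d' h => Quotient.sound h.symm
  -- The cycles occupy disjoint blocks of length `orderOf σ`, which exceeds every index; division by
  -- it recovers the cycle.
  refine ⟨fun d => ((orderOf σ * idx (q d) + i (q d).out d : ℕ) : ℤ), fun d d' h => ?_,
    fun d => ?_⟩
  · have h := Int.ofNat_injective h
    obtain ⟨h1, h2, -⟩ := hi _ d (hq d)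
    obtain ⟨h1', h2', -⟩ := hi _ d' (hq d')
    have e1 := congrArg (· / orderOf σ) h
    simp only [Nat.mul_add_div (orderOf_pos σ), Nat.div_eq_of_lt h2, Nat.div_eq_of_lt h2',
      add_zero] at e1
    have e2 := hidx e1
    rw [e1] at h
    have e3 := Nat.add_left_cancel h
    rw [← h1, ← h1', e3, e2]
  · obtain ⟨-, -, h3⟩ := hi _ d (hq d)
    simp only [hqq _ _ (sameCycle_apply_self σ d)]
    refine h3.imp (fun h => by rw [h]; push_cast; ring) fun h d' hdd' => ?_
    have := h d' ((hq d).trans hdd')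
    simp only [hqq _ _ hdd']
    omega

end Tour

/-! ### Crossing depends only on the order of the ends -/

section CrossCongr

variable {E R R' : Type*} [LinearOrder R] [LinearOrder R'] {pos : E × Bool → R}
  {pos' : E × Bool → R'}

theorem between_congr (h : ∀ d d', pos d < pos d' ↔ pos' d < pos' d') {a : E} {d : E × Bool} :
    Between pos a d ↔ Between pos' a d := by
  simp only [Between, min_lt_iff, max_lt_iff, ← not_lt, h]

variable [CommRing R] [IsStrictOrderedRing R] [CommRing R'] [IsStrictOrderedRing R']

theorem cross_congr (h : ∀ d d', pos d < pos d' ↔ pos' d < pos' d')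
    (hpos : Function.Injective pos) (hpos' : Function.Injective pos') {a b : E} (hab : b ≠ a) :
    Cross pos a b ↔ Cross pos' a b := by
  rw [cross_iff hpos hab, cross_iff hpos' hab, between_congr h, between_congr h]

end CrossCongr

/-! ### Chords of the unit circle -/

section Chords

/-- Twice the signed area of the triangle `p q r`. -/
def orient (p q r : ℂ) : ℝ := (q.re - p.re) * (r.im - p.im) - (q.im - p.im) * (r.re - p.re)

/-- Each segment meets the line of the other where the affine function `orient` vanishes; the
opposite signs make the weights of this zero nonnegative. -/
theorem segment_inter_nonempty {p₀ p₁ q₀ q₁ : ℂ} (hs : orient p₀ p₁ q₀ * orient p₀ p₁ q₁ < 0)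
    (ht : orient q₀ q₁ p₀ * orient q₀ q₁ p₁ < 0) :
    (segment ℝ p₀ p₁ ∩ segment ℝ q₀ q₁).Nonempty := by
  have weights : ∀ {x y : ℝ}, x * y < 0 → x - y ≠ 0 ∧ 0 ≤ -y / (x - y) ∧ 0 ≤ x / (x - y) ∧
      -y / (x - y) + x / (x - y) = 1 := by
    intro x y h
    have hne : x - y ≠ 0 := fun h' => by
      rw [sub_eq_zero.1 h'] at h; nlinarith [mul_self_nonneg y]
    refine ⟨hne, ?_, ?_, ?_⟩
    · rcases mul_neg_iff.1 h with ⟨hx, hy⟩ | ⟨hx, hy⟩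
      · exact div_nonneg (by linarith) (by linarith)
      · exact div_nonneg_of_nonpos (by linarith) (by linarith)
    · rcases mul_neg_iff.1 h with ⟨hx, hy⟩ | ⟨hx, hy⟩
      · exact div_nonneg (by linarith) (by linarith)
      · exact div_nonneg_of_nonpos (by linarith) (by linarith)
    · rw [← add_div, neg_add_eq_sub, div_self hne]
  obtain ⟨hs0, hs1, hs2, hs3⟩ := weights hs
  obtain ⟨ht0, ht1, ht2, ht3⟩ := weights ht
  refine ⟨_, ⟨_, _, ht1, ht2, ht3, rfl⟩, ⟨_, _, hs1, hs2, hs3, ?_⟩⟩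
  have hst : orient q₀ q₁ p₀ - orient q₀ q₁ p₁ = -(orient p₀ p₁ q₀ - orient p₀ p₁ q₁) := by
    simp only [orient]; ring
  rw [hst]
  apply Complex.ext
  · simp only [Complex.add_re, Complex.real_smul, Complex.re_ofReal_mul]
    field_simp
    simp only [orient]; ring
  · simp only [Complex.add_im, Complex.real_smul, Complex.im_ofReal_mul]
    field_simp
    simp only [orient]; ring

theorem segment_inter_empty {p₀ p₁ q₀ q₁ : ℂ} (hs : 0 < orient p₀ p₁ q₀ * orient p₀ p₁ q₁) :
    ¬ (segment ℝ p₀ p₁ ∩ segment ℝ q₀ q₁).Nonempty := by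
  rintro ⟨_, ⟨a, b, -, -, hab, rfl⟩, ⟨c, d, hc, hd, hcd, h⟩⟩
  have h1 : c * orient p₀ p₁ q₀ + d * orient p₀ p₁ q₁ = orient p₀ p₁ (c • q₀ + d • q₁) := by
    obtain rfl : c = 1 - d := by linarith
    simp only [orient, Complex.add_re, Complex.add_im, Complex.real_smul, Complex.re_ofReal_mul,
      Complex.im_ofReal_mul]
    ring
  have h2 : orient p₀ p₁ (a • p₀ + b • p₁) = 0 := by
    obtain rfl : a = 1 - b := by linarith
    simp only [orient, Complex.add_re, Complex.add_im, Complex.real_smul, Complex.re_ofReal_mul,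
      Complex.im_ofReal_mul]
    ring
  rw [h, h2] at h1
  rcases mul_pos_iff.1 hs with ⟨h3, h4⟩ | ⟨h3, h4⟩
  · have := mul_nonneg hc h3.le
    have := mul_nonneg hd h4.le
    have h5 : c * orient p₀ p₁ q₀ = 0 := by linarith
    have h6 : d * orient p₀ p₁ q₁ = 0 := by linarith
    have := (mul_eq_zero.1 h5).resolve_right h3.ne'
    have := (mul_eq_zero.1 h6).resolve_right h4.ne'
    linarith
  · have := mul_nonneg hc (neg_pos.2 h3).le
    have := mul_nonneg hd (neg_pos.2 h4).le
    have h5 : c * orient p₀ p₁ q₀ = 0 := by linarith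
    have h6 : d * orient p₀ p₁ q₁ = 0 := by linarith
    have := (mul_eq_zero.1 h5).resolve_right h3.ne
    have := (mul_eq_zero.1 h6).resolve_right h4.ne
    linarith

/-- The area of an inscribed triangle is a product of sines of half the angle differences, so its
sign depends only on the order of the angles. -/
theorem orient_circle (a b c : ℝ) :
    orient (Circle.exp a) (Circle.exp b) (Circle.exp c) =
      4 * Real.sin ((b - a) / 2) * (Real.sin ((c - a) / 2) * Real.sin ((c - b) / 2)) := by
  simp only [orient, Circle.coe_exp, Complex.exp_ofReal_mul_I_re, Complex.exp_ofReal_mul_I_im]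
  obtain ⟨x, rfl⟩ : ∃ x, a = 2 * x := ⟨a / 2, by ring⟩
  obtain ⟨y, rfl⟩ : ∃ y, b = 2 * y := ⟨b / 2, by ring⟩
  obtain ⟨z, rfl⟩ : ∃ z, c = 2 * z := ⟨c / 2, by ring⟩
  rw [show (2 * y - 2 * x) / 2 = y - x by ring, show (2 * z - 2 * x) / 2 = z - x by ring,
    show (2 * z - 2 * y) / 2 = z - y by ring]
  simp only [Real.sin_two_mul, Real.cos_two_mul', Real.sin_sub]
  have hx := Real.sin_sq_add_cos_sq x
  have hy := Real.sin_sq_add_cos_sq y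
  have hz := Real.sin_sq_add_cos_sq z
  generalize Real.sin x = sx at *
  generalize Real.cos x = cx at *
  generalize Real.sin y = sy at *
  generalize Real.cos y = cy at *
  generalize Real.sin z = sz at *
  generalize Real.cos z = cz at *
  -- The left side has degree four and the right side degree six. Each difference involving two of
  -- the angles is multiplied by `sin ^ 2 + cos ^ 2` of the third.
  linear_combination -((cy ^ 2 - sy ^ 2) * (2 * sz * cz) - (2 * sy * cy) * (cz ^ 2 - sz ^ 2)) * hx
    - ((cz ^ 2 - sz ^ 2) * (2 * sx * cx) - (2 * sz * cz) * (cx ^ 2 - sx ^ 2)) * hy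
    - ((cx ^ 2 - sx ^ 2) * (2 * sy * cy) - (2 * sx * cx) * (cy ^ 2 - sy ^ 2)) * hz

theorem exists_sin_half_eq {x : ℝ} (h : |x| < 2 * Real.pi) :
    ∃ k > 0, Real.sin (x / 2) = k * x := by
  obtain ⟨h1, h2⟩ := abs_lt.1 h
  rcases lt_trichotomy x 0 with hx | rfl | hx
  · refine ⟨Real.sin (x / 2) / x, ?_, (div_mul_cancel₀ _ hx.ne).symm⟩
    exact div_pos_of_neg_of_neg (Real.sin_neg_of_neg_of_neg_pi_lt (by linarith) (by linarith)) hx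
  · exact ⟨1, one_pos, by simp⟩
  · refine ⟨Real.sin (x / 2) / x, ?_, (div_mul_cancel₀ _ hx.ne').symm⟩
    exact div_pos (Real.sin_pos_of_pos_of_lt_pi (by linarith) (by linarith)) hx

variable {Q : Type*}

theorem exists_orient_mul_eq {θ : Q × Bool → ℝ} (hθ : Function.Injective θ)
    (hr : ∀ d, θ d ∈ Set.Ioc (-Real.pi) Real.pi) (a b : Q) :
    ∃ k > 0, orient (Circle.exp (θ (a, false))) (Circle.exp (θ (a, true)))
        (Circle.exp (θ (b, false))) *
      orient (Circle.exp (θ (a, false))) (Circle.exp (θ (a, true))) (Circle.exp (θ (b, true))) =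
      k * ((θ (b, false) - θ (a, false)) * (θ (b, false) - θ (a, true)) *
        ((θ (b, true) - θ (a, false)) * (θ (b, true) - θ (a, true)))) := by
  have key : ∀ d d', ∃ k > 0, Real.sin ((θ d - θ d') / 2) = k * (θ d - θ d') := by
    intro d d'
    have h1 := hr d
    have h2 := hr d'
    refine exists_sin_half_eq (abs_lt.2 ⟨?_, ?_⟩) <;> linarith [h1.1, h1.2, h2.1, h2.2]
  obtain ⟨k, hk, e⟩ := key (a, true) (a, false)
  obtain ⟨k₁, hk₁, e₁⟩ := key (b, false) (a, false)
  obtain ⟨k₂, hk₂, e₂⟩ := key (b, false) (a, true)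
  obtain ⟨k₃, hk₃, e₃⟩ := key (b, true) (a, false)
  obtain ⟨k₄, hk₄, e₄⟩ := key (b, true) (a, true)
  have hne : θ (a, true) - θ (a, false) ≠ 0 := sub_ne_zero.2 fun h => by simpa using hθ h
  refine ⟨(4 * k * (θ (a, true) - θ (a, false))) ^ 2 * (k₁ * k₂ * (k₃ * k₄)), ?_, ?_⟩
  · have : 0 < (4 * k * (θ (a, true) - θ (a, false))) ^ 2 := by positivity
    positivity
  · rw [orient_circle, orient_circle, e, e₁, e₂, e₃, e₄]
    ring

theorem chords_inter_iff_cross {θ : Q × Bool → ℝ} (hθ : Function.Injective θ)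
    (hr : ∀ d, θ d ∈ Set.Ioc (-Real.pi) Real.pi) {a b : Q} (hab : b ≠ a) :
    (segment ℝ (Circle.exp (θ (a, false)) : ℂ) (Circle.exp (θ (a, true))) ∩
        segment ℝ (Circle.exp (θ (b, false)) : ℂ) (Circle.exp (θ (b, true)))).Nonempty ↔
      Cross θ a b := by
  obtain ⟨k, hk, e⟩ := exists_orient_mul_eq hθ hr a b
  obtain ⟨l, hl, e'⟩ := exists_orient_mul_eq hθ hr b a
  have hne : (θ (b, false) - θ (a, false)) * (θ (b, false) - θ (a, true)) *
      ((θ (b, true) - θ (a, false)) * (θ (b, true) - θ (a, true))) ≠ 0 :=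
    mul_ne_zero (mul_ne_zero_of_ne hθ hab) (mul_ne_zero_of_ne hθ hab)
  constructor
  · intro h
    by_contra hc
    refine segment_inter_empty ?_ h
    rw [e]
    exact mul_pos hk (lt_of_le_of_ne (not_lt.1 hc) hne.symm)
  · intro h
    refine segment_inter_nonempty ?_ ?_
    · rw [e]
      exact mul_neg_of_pos_of_neg hk h
    · rw [e']
      exact mul_neg_of_pos_of_neg hl ((cross_comm θ a b).1 h)

/-- Opening the circle at one point turns chords into pairs of reals. The argument goes one way; `2
* arctan`, which maps the line increasingly into the range of arguments, goes back. -/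
theorem isCircleGraph_iff {G : SimpleGraph Q} : IsCircleGraph G ↔
    ∃ pos : Q × Bool → ℝ, Function.Injective pos ∧
      ∀ a b, G.Adj a b ↔ a ≠ b ∧ Cross pos a b := by
  constructor
  · rintro ⟨p, hp, h⟩
    have harg : Function.Injective fun d => (p d : ℂ).arg := Circle.injective_arg.comp hp
    refine ⟨fun d => (p d : ℂ).arg, harg, fun a b => (h a b).trans (and_congr_right fun hab => ?_)⟩
    rw [← chords_inter_iff_cross harg (fun d => Complex.arg_mem_Ioc _) (Ne.symm hab)]
    simp only [Circle.exp_arg]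
  · rintro ⟨pos, hpos, h⟩
    have hmono : StrictMono fun x : ℝ => 2 * Real.arctan x := fun x y hxy =>
      mul_lt_mul_of_pos_left (Real.arctan_strictMono hxy) two_pos
    have hr : ∀ x : ℝ, 2 * Real.arctan x ∈ Set.Ioc (-Real.pi) Real.pi := fun x =>
      ⟨by linarith [Real.neg_pi_div_two_lt_arctan x], by linarith [Real.arctan_lt_pi_div_two x]⟩
    have hinj : Function.Injective fun d => 2 * Real.arctan (pos d) := hmono.injective.comp hpos
    refine ⟨fun d => Circle.exp (2 * Real.arctan (pos d)), fun d d' hd => hinj ?_, fun a b =>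
      (h a b).trans (and_congr_right fun hab => ?_)⟩
    · have := congrArg (fun z : Circle => (z : ℂ).arg) hd
      simpa only [Circle.arg_exp (hr _).1 (hr _).2] using this
    · rw [chords_inter_iff_cross hinj (fun d => hr _) (Ne.symm hab),
        cross_congr (fun _ _ => hmono.lt_iff_lt) hinj hpos (Ne.symm hab)]

end Chords

/-! ### Fundamental cycles -/

section Cycles

variable {V E : Type*} {vert : E × Bool → V}

/-- `S` is the edge set of a path (without repeated vertices) from `x` to `y`. -/
inductive IsPathSet (vert : E × Bool → V) : Set E → V → V → Prop
  | nil (x : V) : IsPathSet vert ∅ x x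
  | cons (d : E × Bool) {S : Set E} {y : V} (h : IsPathSet vert S (vert (revDart d)) y)
      (hd : vert (revDart d) ≠ vert d) (hS : ∀ d', d'.1 ∈ S → vert d' ≠ vert d)
      (hy : y ≠ vert d) : IsPathSet vert (insert d.1 S) (vert d) y

theorem eq_or_eq_revDart {d d' : E × Bool} (h : d'.1 = d.1) : d' = d ∨ d' = revDart d := by
  obtain ⟨e, b⟩ := d
  obtain ⟨e', b'⟩ := d'
  obtain rfl : e' = e := h
  cases b <;> cases b' <;> simp [revDart]

theorem IsPathSet.exists_subpath {S : Set E} {z y : V} (h : IsPathSet vert S z y) (x : V)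
    (hx : x = z ∨ x = y ∨ ∃ d, d.1 ∈ S ∧ vert d = x) : ∃ S' ⊆ S, IsPathSet vert S' x y := by
  induction h with
  | nil z =>
    refine ⟨∅, subset_rfl, ?_⟩
    rcases hx with rfl | rfl | ⟨d, hd, -⟩
    · exact .nil _
    · exact .nil _
    · exact absurd hd (Set.notMem_empty _)
  | @cons d S y h hd hS hy ih =>
    rcases hx with rfl | rfl | ⟨d', hd', rfl⟩
    · exact ⟨_, subset_rfl, .cons d h hd hS hy⟩
    · exact ⟨∅, Set.empty_subset _, .nil _⟩
    · rcases hd' with hd' | hd'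
      · rcases eq_or_eq_revDart hd' with rfl | rfl
        · exact ⟨_, subset_rfl, .cons d' h hd hS hy⟩
        · exact ⟨S, Set.subset_insert _ _, h⟩
      · obtain ⟨S', hS', h'⟩ := ih (.inr (.inr ⟨d', hd', rfl⟩))
        exact ⟨S', hS'.trans (Set.subset_insert _ _), h'⟩

/-- Having a path to `y` is invariant along each edge: prepend the edge, or, if its start already
lies on the path, cut the path there. -/
theorem EdgeReach.exists_isPathSet {T : Set E} {x y : V} (h : EdgeReach vert T x y) :
    ∃ S ⊆ T, IsPathSet vert S x y := by
  have step : ∀ d : E × Bool, d.1 ∈ T → (∃ S ⊆ T, IsPathSet vert S (vert (revDart d)) y) →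
      ∃ S ⊆ T, IsPathSet vert S (vert d) y := by
    rintro d hd ⟨S, hS, hp⟩
    by_cases hx : vert d = vert (revDart d) ∨ vert d = y ∨ ∃ d', d'.1 ∈ S ∧ vert d' = vert d
    · obtain ⟨S', hS', h'⟩ := hp.exists_subpath _ hx
      exact ⟨S', hS'.trans hS, h'⟩
    · push Not at hx
      exact ⟨_, Set.insert_subset hd hS, .cons d hp hx.1.symm hx.2.2 hx.2.1.symm⟩
  have := h.lift (r := fun x x' => (∃ S ⊆ T, IsPathSet vert S x y) ↔
    ∃ S ⊆ T, IsPathSet vert S x' y) ⟨fun _ => Iff.rfl, Iff.symm, Iff.trans⟩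
    fun e he => ⟨step (e, true) he, step (e, false) he⟩
  exact this.2 ⟨∅, Set.empty_subset _, .nil y⟩

theorem IsPathSet.edgeReach {S : Set E} {x y : V} (h : IsPathSet vert S x y) :
    EdgeReach vert S x y ∧ ∀ d, d.1 ∈ S → EdgeReach vert S x (vert d) := by
  induction h with
  | nil x => exact ⟨.refl _, fun d hd => absurd hd (Set.notMem_empty _)⟩
  | @cons d S y _ _ _ _ ih =>
    have h1 : EdgeReach vert (insert d.1 S) (vert d) (vert (revDart d)) :=
      .of_dart (Set.mem_insert _ _)
    refine ⟨h1.trans (ih.1.mono (Set.subset_insert _ _)), fun d' hd' => ?_⟩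
    rcases hd' with hd' | hd'
    · rcases eq_or_eq_revDart hd' with rfl | rfl
      · exact .refl _
      · exact h1
    · exact h1.trans ((ih.2 d' hd').mono (Set.subset_insert _ _))

open scoped Classical in
theorem ncard_darts_insert [Finite E] {S : Set E} {d : E × Bool} (hd : d.1 ∉ S) (v : V) :
    Set.ncard {d' : E × Bool | d'.1 ∈ insert d.1 S ∧ vert d' = v} =
      Set.ncard {d' : E × Bool | d'.1 ∈ S ∧ vert d' = v} +
        ((if vert d = v then 1 else 0) + if vert (revDart d) = v then 1 else 0) := by
  have h1 : {d' : E × Bool | d'.1 ∈ insert d.1 S ∧ vert d' = v} =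
      {d' : E × Bool | d'.1 ∈ S ∧ vert d' = v} ∪ Prod.mk d.1 '' {b | vert (d.1, b) = v} := by
    ext ⟨e, b⟩
    simp only [Set.mem_ofPred_eq, Set.mem_insert_iff, Set.mem_union, Set.mem_image, Prod.mk.injEq]
    constructor
    · rintro ⟨rfl | h, h'⟩
      · exact .inr ⟨b, h', rfl, rfl⟩
      · exact .inl ⟨h, h'⟩
    · rintro (⟨h, h'⟩ | ⟨b, h, rfl, rfl⟩)
      · exact ⟨.inr h, h'⟩
      · exact ⟨.inl rfl, h⟩
  rw [h1, Set.ncard_union_eq ?_ (Set.toFinite _) (Set.toFinite _),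
    Set.ncard_image_of_injective _ (Prod.mk_right_injective _), ncard_ends]
  · obtain ⟨e, b⟩ := d
    cases b
    · rfl
    · simp only [revDart, Bool.not_true]
      omega
  · rw [Set.disjoint_left]
    rintro _ ⟨h, -⟩ ⟨b, -, rfl⟩
    exact hd h

-- The added terms count the ends of an imaginary edge from `x` to `y`, which closes the path to a
-- cycle; this edge later becomes the nonforest edge.
open scoped Classical in
theorem IsPathSet.ncard_darts [Finite E] {S : Set E} {x y : V} (h : IsPathSet vert S x y)
    (v : V) : Set.ncard {d : E × Bool | d.1 ∈ S ∧ vert d = v} +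
      ((if x = v then 1 else 0) + if y = v then 1 else 0) ∈ ({0, 2} : Set ℕ) := by
  induction h with
  | nil x =>
    by_cases h : x = v <;> simp [h]
  | @cons d S y _ hd hS hy ih =>
    have hdS : d.1 ∉ S := fun h => hS d h rfl
    rw [ncard_darts_insert hdS]
    by_cases hv : vert d = v
    · have h0 : {d' : E × Bool | d'.1 ∈ S ∧ vert d' = v} = ∅ :=
        Set.eq_empty_of_forall_notMem fun d' hd' => hS d' hd'.1 (hd'.2.trans hv.symm)
      rw [h0, Set.ncard_empty, if_pos hv, if_neg fun h => hd (h.trans hv.symm),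
        if_neg fun h => hy (h.trans hv.symm)]
      simp
    · rw [if_neg hv]
      convert ih using 1
      omega

end Cycles

/-! ### Adjacency in the fundamental graph -/

namespace PlaneMultigraph

variable {V E F : Type*} (P : PlaneMultigraph V E F) {T : Set E}

/-- Cycles are orthogonal to cuts: in the sum over the darts of `C`, the value of the potential at
each vertex occurs an even number of times. -/
theorem IsCycle.sum_eq_zero [Fintype V] [Fintype E] {P : PlaneMultigraph V E F} {C : Set E}
    [DecidablePred (· ∈ C)] (hC : P.IsCycle C) {x : E → ZMod 2}
    (hx : x ∈ (coboundary P.vert).range) : ∑ e, (if e ∈ C then x e else 0) = 0 := by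
  classical
  obtain ⟨c, rfl⟩ := hx
  have h1 : ∑ e, (if e ∈ C then coboundary P.vert c e else 0) =
      ∑ d : E × Bool with d.1 ∈ C, c (P.vert d) := by
    rw [Finset.sum_filter, Fintype.sum_prod_type]
    refine Finset.sum_congr rfl fun e _ => ?_
    simp only [Fintype.sum_bool, coboundary_apply]
    split_ifs
    · exact add_comm _ _
    · simp
  rw [h1, ← Finset.sum_fiberwise _ P.vert]
  refine Finset.sum_eq_zero fun v _ => ?_
  rw [Finset.sum_congr rfl fun d hd => congrArg c (Finset.mem_filter.1 hd).2, Finset.sum_const,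
    Finset.filter_filter]
  have h2 := hC.2.2 v
  rw [show {d : E × Bool | d.1 ∈ C ∧ P.vert d = v} =
    ((Finset.univ.filter fun d : E × Bool => d.1 ∈ C ∧ P.vert d = v : Finset _) : Set _) by simp,
    Set.ncard_coe_finset] at h2
  rcases h2 with h2 | h2
  · rw [h2, zero_smul]
  · rw [Set.mem_singleton_iff.1 h2, two_nsmul, CharTwo.add_self_eq_zero]

/-- A cycle in `insert a T` through `t` meets the fundamental cut of `t` in an even number of edges,
and besides `t` only `a` is available. Conversely, `a` closes the forest path between its ends, and
this path uses `t` if its removal separates them. -/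
theorem onFundamentalCycle_iff [Fintype V] [Fintype E] (hT : P.IsSpanningForest T) {a t : E}
    (ha : a ∉ T) (ht : t ∈ T) : P.OnFundamentalCycle T a t ↔
      ¬ EdgeReach P.vert (T \ {t}) (P.vert (a, false)) (P.vert (a, true)) := by
  classical
  have hF : IsForestOf P.vert T := hT
  have hat : a ≠ t := fun h => ha (h ▸ ht)
  constructor
  · rintro ⟨C, hC, hCT, haC, htC⟩ h
    have h1 := hC.sum_eq_zero (hF.fundamentalCut_mem ht)
    rw [Finset.sum_eq_single t, if_pos htC, hF.fundamentalCut_self ht] at h1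
    · exact one_ne_zero h1
    · intro e _ he
      split_ifs with heC
      · rcases hCT heC with rfl | heT
        · exact fundamentalCut_eq_zero_iff.2 h
        · exact fundamentalCut_of_ne heT he
      · rfl
    · simp
  · intro h
    obtain ⟨S, hST, hS⟩ := (hF.1 _ _ (.of_mem (Set.mem_univ a) false true)).exists_isPathSet
    have hr := hS.edgeReach
    have haS : a ∉ S := fun h => ha (hST h)
    have hC : ∀ d : E × Bool, d.1 ∈ insert a S →
        EdgeReach P.vert (insert a S) (P.vert (a, false)) (P.vert d) := by
      rintro ⟨e, b⟩ (hd | hd)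
      · obtain rfl : e = a := hd
        exact .of_mem (Set.mem_insert _ _) _ _
      · exact (hr.2 _ hd).mono (Set.subset_insert _ _)
    refine ⟨insert a S, ⟨⟨a, Set.mem_insert _ _⟩, fun d d' hd hd' => (hC d hd).symm.trans (hC d' hd'),
      fun v => ?_⟩, Set.insert_subset_insert hST, Set.mem_insert _ _, Set.mem_insert_of_mem _ ?_⟩
    · rw [show a = ((a, false) : E × Bool).1 from rfl, ncard_darts_insert haS]
      exact hS.ncard_darts v
    · by_contra htS
      exact h (hr.1.mono (T := T \ {t}) fun e he => ⟨hST he, fun h' => htS (h' ▸ he)⟩)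

theorem fundamentalGraph_adj_iff [Fintype V] [Fintype E] (hT : P.IsSpanningForest T) {a t : E}
    (ha : a ∉ T) (ht : t ∈ T) : (P.fundamentalGraph T).Adj a t ↔
      ¬ EdgeReach P.vert (T \ {t}) (P.vert (a, false)) (P.vert (a, true)) := by
  rw [← P.onFundamentalCycle_iff hT ha ht]
  simp [fundamentalGraph, ha, ht]

theorem fundamentalGraph_isBipartite (T : Set E) : (P.fundamentalGraph T).IsBipartite := by
  classical
  refine ⟨SimpleGraph.Coloring.mk (fun e => if e ∈ T then 0 else 1) ?_⟩
  rintro a b (⟨ha, hb, -⟩ | ⟨hb, ha, -⟩) <;> simp [ha, hb]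

/-! ### The cut space and the cycle space -/

theorem vert_rot (d : E × Bool) : P.vert (P.rot d) = P.vert d :=
  ((P.sameCycle_rot_iff _ _).1 (sameCycle_apply_self P.rot d)).symm

theorem edgeReach_face_of_vert_eq {d d' : E × Bool} (h : P.vert d = P.vert d') :
    EdgeReach P.face Set.univ (P.face d) (P.face d') := by
  refine ((P.sameCycle_rot_iff d d').2 h).lift
    (r := fun d d' => EdgeReach P.face Set.univ (P.face d) (P.face d'))
    ⟨fun _ => .refl _, .symm, .trans⟩ fun d => ?_
  have := P.face_next (revDart d)
  rw [revDart_revDart] at this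
  rw [this]
  exact .of_dart (Set.mem_univ _)

/-- The dual is connected even if `P` is not: turning around a vertex crosses one edge per step, and
`linked` chains such turns together. -/
theorem edgeReach_face (f g : F) : EdgeReach P.face Set.univ f g := by
  classical
  let c : V ⊕ F → F := Sum.elim
    (fun v => if h : ∃ d, P.vert d = v then P.face h.choose else P.pointFace v) id
  have key : ∀ x y : V ⊕ F, Relation.EqvGen
    (fun x y => ∃ a f, x = Sum.inl a ∧ y = Sum.inr f ∧
      ((∃ d, P.vert d = a ∧ P.face d = f) ∨ ((∀ d, P.vert d ≠ a) ∧ P.pointFace a = f))) x y →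
      EdgeReach P.face Set.univ (c x) (c y) := by
    intro x y h
    induction h with
    | rel x y h =>
      obtain ⟨v, f, rfl, rfl, ⟨d, rfl, rfl⟩ | ⟨hv, rfl⟩⟩ := h
      · have hex : ∃ d', P.vert d' = P.vert d := ⟨d, rfl⟩
        simp only [c, Sum.elim_inl, Sum.elim_inr, dif_pos hex, id]
        exact P.edgeReach_face_of_vert_eq hex.choose_spec
      · have hex : ¬ ∃ d, P.vert d = v := fun ⟨d, hd⟩ => hv d hd
        simp only [c, Sum.elim_inl, Sum.elim_inr, dif_neg hex, id]
        exact .refl _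
    | refl x => exact .refl _
    | symm x y _ ih => exact ih.symm
    | trans x y z _ _ ih ih' => exact ih.trans ih'
  exact key _ _ (P.linked (Sum.inr f) (Sum.inr g))

theorem numComponents_face : numComponents P.face = 1 := by
  have : Nonempty F := by
    by_contra hF
    rw [not_nonempty_iff] at hF
    have : IsEmpty V := Function.isEmpty P.pointFace
    have : IsEmpty E := Function.isEmpty fun e => P.face (e, false)
    have : IsEmpty (Quot (EdgeReach P.vert Set.univ)) := Quot.instIsEmpty
    simpa [numComponents] using P.euler
  exact numComponents_eq_one _ P.edgeReach_face

/-- Each pair of a side on `f` and an end at `v` of the same edge is a dart of `f` that starts or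
ends at `v`. The step to the next dart of the boundary walk matches the two kinds, so their number
is even. -/
theorem incidence_face_mul_transpose [Fintype E] :
    incidence P.face * (incidence P.vert).transpose = 0 := by
  classical
  ext f v
  set g : E × Bool → ZMod 2 := fun d =>
    (if P.face d = f then 1 else 0) * if P.vert d = v then 1 else 0 with hg
  have h1 : ∑ d : E × Bool, g (P.rot (revDart d)) = ∑ d, g d := by
    refine Equiv.sum_comp (P.rot * flipOn Set.univ) g |>.symm.trans ?_ |>.symm
    exact Finset.sum_congr rfl fun d _ => by
      rw [Equiv.Perm.mul_apply, flipOn_univ_apply]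
  have h2 : ∀ e : E, incidence P.face f e * incidence P.vert v e =
      ∑ b, (g (e, b) + g (P.rot (revDart (e, b)))) := by
    intro e
    have h3 : ∀ d, g (P.rot (revDart d)) =
        (if P.face d = f then 1 else 0) * if P.vert (revDart d) = v then 1 else 0 := fun d => by
      simp only [hg, P.face_next, P.vert_rot]
    rw [Fintype.sum_bool, h3, h3]
    simp only [hg, incidence_apply, revDart,
      Bool.not_true, Bool.not_false]
    ring
  rw [Matrix.mul_apply]
  simp only [Matrix.transpose_apply, h2]
  rw [← Fintype.sum_prod_type (f := fun d => g d + g (P.rot (revDart d))), Finset.sum_add_distrib,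
    h1, CharTwo.add_self_eq_zero]
  rfl

theorem rank_add_rank [Fintype V] [Fintype E] [Fintype F] : (incidence P.vert).rank + (incidence P.face).rank = Fintype.card E := by
  have h1 := rank_incidence P.vert
  have h2 := rank_incidence P.face
  have h3 := P.euler
  rw [P.numComponents_face] at h2
  rw [← Nat.card_eq_fintype_card]
  omega

end PlaneMultigraph

/-- Orthogonality gives one inclusion, and the ranks force equality. The statement is symmetric in
vertices and faces, so it also serves for the dual. -/
theorem ker_mulVec_eq_range_coboundary {W X E : Type*} [Fintype W] [Fintype X] [Fintype E]
    {vert : E × Bool → W} {face : E × Bool → X}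
    (h : incidence face * (incidence vert).transpose = 0)
    (hr : (incidence vert).rank + (incidence face).rank = Fintype.card E) (x : E → ZMod 2) :
    (incidence face).mulVec x = 0 ↔ x ∈ (coboundary vert).range := by
  have e1 : (incidence vert).transpose.mulVecLin = coboundary vert :=
    LinearMap.ext (transpose_incidence_mulVec vert)
  have h1 : (coboundary vert).range = (incidence face).mulVecLin.ker := by
    refine Submodule.eq_of_le_of_finrank_eq ?_ ?_
    · rw [← e1, LinearMap.range_le_ker_iff, ← Matrix.mulVecLin_mul, h, Matrix.mulVecLin_zero]
    · have h2 := (incidence face).mulVecLin.finrank_range_add_finrank_ker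
      rw [Module.finrank_fintype_fun_eq_card, ← hr, ← Matrix.rank] at h2
      rw [← e1, ← Matrix.rank, Matrix.rank_transpose]
      omega
  rw [h1]
  rfl

/-! ### Duality and the chord diagram of a spanning forest -/

namespace PlaneMultigraph

variable {V E F : Type*} [Fintype V] [Fintype E] [Fintype F] (P : PlaneMultigraph V E F)

theorem face_mulVec_eq_zero_iff (x : E → ZMod 2) :
    (incidence P.face).mulVec x = 0 ↔ x ∈ (coboundary P.vert).range :=
  ker_mulVec_eq_range_coboundary P.incidence_face_mul_transpose P.rank_add_rank x

theorem vert_mulVec_eq_zero_iff (x : E → ZMod 2) :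
    (incidence P.vert).mulVec x = 0 ↔ x ∈ (coboundary P.face).range := by
  refine ker_mulVec_eq_range_coboundary ?_ ((add_comm _ _).trans P.rank_add_rank) x
  have := congrArg Matrix.transpose P.incidence_face_mul_transpose
  rwa [Matrix.transpose_mul, Matrix.transpose_transpose, Matrix.transpose_zero] at this

/-- In the dual, the complement of a spanning forest is acyclic. -/
theorem dual_acyclic {T : Set E} (hT : P.IsSpanningForest T) (a : E) (ha : a ∈ Tᶜ) :
    ¬ EdgeReach P.face (Tᶜ \ {a}) (P.face (a, false)) (P.face (a, true)) := by
  classical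
  have hF : IsForestOf P.vert T := hT
  -- This is the indicator of the fundamental cycle of `a`. As a cycle it is a dual cut; among the
  -- edges outside `T` only `a` lies in it, so the dual potential separates the two faces at `a`.
  set y : E → ZMod 2 := fun e =>
    (if e = a then 1 else 0) + if e ∈ T then fundamentalCut P.vert T e a else 0 with hy
  have h1 : (incidence P.vert).mulVec y = 0 := by
    ext v
    have hx := row_incidence_mem P.vert v
    have h2 := congrFun (hF.eq_cutWith hx fun _ _ => rfl) a
    rw [cutWith_apply] at h2
    have h3 : (incidence P.vert).mulVec y v =
        incidence P.vert v a + ∑ t, if t ∈ T then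
          incidence P.vert v t * fundamentalCut P.vert T t a else 0 := by
      simp [Matrix.mulVec, dotProduct, hy, mul_add, Finset.sum_add_distrib]
    rw [h3, ← h2, CharTwo.add_self_eq_zero]
    rfl
  obtain ⟨c, hc⟩ := (P.vert_mulVec_eq_zero_iff y).1 h1
  intro h
  have h4 : c (P.face (a, false)) = c (P.face (a, true)) := h.apply_eq fun e he => by
    rw [← coboundary_apply_eq_zero_iff, hc, hy]
    simp only [Set.mem_sdiff, Set.mem_compl_iff, Set.mem_singleton_iff] at he
    simp [he.1, he.2]
  rw [← coboundary_apply_eq_zero_iff, hc, hy] at h4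
  simp only [if_true, if_neg (show a ∉ T from ha), add_zero] at h4
  exact one_ne_zero h4

open Equiv Equiv.Perm in
theorem isCircleGraph_fundamentalGraph {T : Set E} (hT : P.IsSpanningForest T) :
    IsCircleGraph (P.fundamentalGraph T) := by
  classical
  have hF : IsForestOf P.vert T := hT
  set σ := P.rot * flipOn T with hσ
  set φ := P.rot * flipOn Set.univ with hφ
  have hσφ : σ = φ * flipOn Tᶜ := by
    rw [hφ, mul_assoc, flipOn_mul_of_subset (Set.subset_univ _), ← Set.compl_eq_univ_sdiff,
      compl_compl]
  have hσe : ∀ e, σ.SameCycle (e, false) (e, true) := fun e => by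
    rw [hσ, sameCycle_mul_flipOn_iff_of_acyclic P.sameCycle_rot_iff hF.2 subset_rfl]
    exact hF.1 _ _ (.of_mem (Set.mem_univ e) _ _)
  have htree : ∀ t ∈ T, ∀ d d', (σ * swap (t, false) (t, true)).SameCycle d d' ↔
      EdgeReach P.vert (T \ {t}) (P.vert d) (P.vert d') := fun t ht d d' => by
    rw [hσ, mul_assoc, flipOn_mul_swap_of_mem ht]
    exact sameCycle_mul_flipOn_iff_of_acyclic P.sameCycle_rot_iff hF.2 Set.sdiff_subset d d'
  -- The cycles of `φ` are boundary walks. In a disconnected `P` a face may have several, so they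
  -- are used in place of `P.face`; acyclicity transfers because walks map to faces.
  let fc : E × Bool → Quotient (SameCycle.setoid φ) := Quotient.mk _
  have hfc : ∀ d d', φ.SameCycle d d' ↔ fc d = fc d' := fun d d' =>
    ⟨fun h => Quotient.sound h, fun h => Quotient.exact h⟩
  have hface : ∀ d d', φ.SameCycle d d' → P.face d = P.face d' := fun d d' h =>
    h.lift (r := fun d d' => P.face d = P.face d') ⟨fun _ => rfl, Eq.symm, Eq.trans⟩ fun d => by
      rw [hφ, mul_apply, flipOn_univ_apply, P.face_next]
  have hacy : ∀ a ∈ Tᶜ, ¬ EdgeReach fc (Tᶜ \ {a}) (fc (a, false)) (fc (a, true)) :=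
    fun a ha h => P.dual_acyclic hT a ha
      (h.map (g := Quotient.lift P.face hface) (vert' := P.face) fun _ => rfl)
  have hcotree : ∀ a ∈ Tᶜ, ∀ d d', (σ * swap (a, false) (a, true)).SameCycle d d' ↔
      EdgeReach fc (Tᶜ \ {a}) (fc d) (fc d') := fun a ha d d' => by
    rw [hσφ, mul_assoc, flipOn_mul_swap_of_mem ha]
    exact sameCycle_mul_flipOn_iff_of_acyclic hfc hacy Set.sdiff_subset d d'
  obtain ⟨pos, hpos⟩ := exists_isTour σ
  have hmono : StrictMono fun n : ℤ => (n : ℝ) := Int.cast_strictMono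
  rw [isCircleGraph_iff]
  refine ⟨fun d => (pos d : ℝ), hmono.injective.comp hpos.1, fun a b => ?_⟩
  by_cases hab : a = b
  · subst hab
    simp
  rw [cross_congr (fun _ _ => hmono.lt_iff_lt) (hmono.injective.comp hpos.1) hpos.1
    (Ne.symm hab), and_iff_right hab]
  by_cases ha : a ∈ T <;> by_cases hb : b ∈ T
  · rw [hpos.cross_iff hσe (Ne.symm hab), htree a ha]
    refine iff_of_false (by simp [fundamentalGraph, ha, hb]) ?_
    exact not_not.2 (.of_mem (S := T \ {a}) ⟨hb, Ne.symm hab⟩ _ _)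
  · rw [hpos.cross_iff hσe (Ne.symm hab), htree a ha, SimpleGraph.adj_comm,
      P.fundamentalGraph_adj_iff hT hb ha]
  · rw [cross_comm, hpos.cross_iff hσe hab, htree b hb, P.fundamentalGraph_adj_iff hT ha hb]
  · rw [hpos.cross_iff hσe (Ne.symm hab), hcotree a ha]
    refine iff_of_false (by simp [fundamentalGraph, ha, hb]) ?_
    exact not_not.2 (.of_mem (S := Tᶜ \ {a}) ⟨hb, Ne.symm hab⟩ _ _)

end PlaneMultigraph

/-! ### Tensor products of one-qubit operators -/

section Operators

/-- The sign `(-1) ^ a`. -/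
def zsign (a : ZMod 2) : ℂ := if a = 0 then 1 else -1

@[simp]
theorem zsign_zero : zsign 0 = 1 := rfl

theorem zmod_two_cases (a : ZMod 2) : a = 0 ∨ a = 1 := by
  revert a; decide

theorem zsign_one : zsign 1 = -1 := if_neg one_ne_zero

theorem zsign_add (a b : ZMod 2) : zsign (a + b) = zsign a * zsign b := by
  rcases zmod_two_cases a with rfl | rfl <;> rcases zmod_two_cases b with rfl | rfl <;>
    simp [zsign_one, CharTwo.add_self_eq_zero]

theorem zsign_sum {ι : Type*} (s : Finset ι) (f : ι → ZMod 2) :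
    zsign (∑ i ∈ s, f i) = ∏ i ∈ s, zsign (f i) := by
  classical
  induction s using Finset.induction_on with
  | empty => simp
  | insert i s hi ih => rw [Finset.sum_insert hi, Finset.prod_insert hi, zsign_add, ih]

/-- Basis labels in `Fin 2` are read in `ZMod 2`, so that bit strings can be added and compared with
cuts. -/
theorem pauliZ_pow_apply (n : ℕ) (a b : ZMod 2) :
    (pauliZ ^ n) a b = if b = a then zsign (n * a) else 0 := by
  have h2 : pauliZ ^ 2 = 1 := by
    ext i j; fin_cases i <;> fin_cases j <;> simp [pauliZ, pow_two]
  rcases Nat.even_or_odd' n with ⟨k, rfl | rfl⟩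
  · rw [pow_mul, h2, one_pow]
    have : ((2 * k : ℕ) : ZMod 2) = 0 := by
      rw [Nat.cast_mul]; exact zero_mul _
    rw [this, zero_mul, zsign_zero]
    exact (Matrix.one_apply (i := (a : Fin 2)) (j := b)).trans (if_congr eq_comm rfl rfl)
  · rw [pow_succ, pow_mul, h2, one_pow, one_mul]
    have : ((2 * k + 1 : ℕ) : ZMod 2) = 1 := by
      rw [Nat.cast_add, Nat.cast_mul]; exact (congrArg (· + _) (zero_mul _)).trans (by simp)
    rw [this, one_mul]
    rcases zmod_two_cases a with rfl | rfl <;> rcases zmod_two_cases b with rfl | rfl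
    · rfl
    · rfl
    · rfl
    · rfl

theorem pauliX_pow_apply (n : ℕ) (a b : ZMod 2) :
    (pauliX ^ n) a b = if b = a + n then 1 else 0 := by
  have h2 : pauliX ^ 2 = 1 := by
    ext i j; fin_cases i <;> fin_cases j <;> simp [pauliX, pow_two]
  rcases Nat.even_or_odd' n with ⟨k, rfl | rfl⟩
  · rw [pow_mul, h2, one_pow]
    have : ((2 * k : ℕ) : ZMod 2) = 0 := by
      rw [Nat.cast_mul]; exact zero_mul _
    rw [this, add_zero]
    exact (Matrix.one_apply (i := (a : Fin 2)) (j := b)).trans (if_congr eq_comm rfl rfl)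
  · rw [pow_succ, pow_mul, h2, one_pow, one_mul]
    have : ((2 * k + 1 : ℕ) : ZMod 2) = 1 := by
      rw [Nat.cast_add, Nat.cast_mul]; exact (congrArg (· + _) (zero_mul _)).trans (by simp)
    rw [this]
    rcases zmod_two_cases a with rfl | rfl <;> rcases zmod_two_cases b with rfl | rfl
    · rfl
    · rfl
    · rfl
    · rfl

theorem hadamard_apply (a b : ZMod 2) :
    hadamard a b = ((1 / Real.sqrt 2 : ℝ) : ℂ) * zsign (a * b) := by
  rcases zmod_two_cases a with rfl | rfl <;> rcases zmod_two_cases b with rfl | rfl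
  · exact congrArg _ rfl
  · exact congrArg _ rfl
  · exact congrArg _ rfl
  · exact congrArg _ rfl

theorem eqUpToPhase_smul {z : ℂ} (hz : ‖z‖ = 1) {Q : Type*} (ψ : QState Q) : EqUpToPhase (z • ψ) ψ :=
  ⟨z.arg, by
    congr 1
    conv_lhs => rw [← Complex.norm_mul_exp_arg_mul_I z, hz]
    rw [Complex.ofReal_one, one_mul, mul_comm]⟩

theorem EqUpToPhase.symm {Q : Type*} {φ ψ : QState Q} (h : EqUpToPhase φ ψ) : EqUpToPhase ψ φ := by
  obtain ⟨θ, rfl⟩ := h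
  refine ⟨-θ, ?_⟩
  rw [smul_smul, ← Complex.exp_add]
  simp

theorem tensorOp_one {Q : Type*} [Fintype Q] : tensorOp (fun _ : Q => (1 : QubitOp)) = 1 := by
  ext x y
  simp only [tensorOp, Matrix.of_apply, Matrix.one_apply]
  by_cases h : x = y
  · simp [h]
  · obtain ⟨q, hq⟩ := Function.ne_iff.1 h
    rw [if_neg h]
    exact Finset.prod_eq_zero (Finset.mem_univ q) (if_neg hq)

variable {Q : Type*} [Fintype Q] [DecidableEq Q]

theorem tensorOp_mulVec_of_monomial {A : Q → QubitOp} {g : Q → ZMod 2 → ZMod 2}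
    {h : Q → ZMod 2 → ℂ} (hA : ∀ q (a b : ZMod 2), A q a b = if b = g q a then h q a else 0)
    (ψ : QState Q) (x : Q → ZMod 2) :
    (tensorOp A).mulVec ψ x = (∏ q, h q (x q)) * ψ fun q => g q (x q) := by
  refine (Finset.sum_eq_single (f := fun y : Q → Fin 2 => tensorOp A x y * ψ y)
    (fun q => g q (x q)) (fun y _ hy => ?_) fun h => absurd (Finset.mem_univ _) h).trans ?_
  · obtain ⟨q, hq⟩ := Function.ne_iff.1 hy
    exact mul_eq_zero_of_left
      (Finset.prod_eq_zero (Finset.mem_univ q) ((hA q _ _).trans (if_neg hq))) _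
  · exact congrArg (· * _) (Finset.prod_congr rfl fun q _ => (hA q _ _).trans (if_pos rfl))

theorem tensorOp_pauliZ_mulVec (n : Q → ℕ) (ψ : QState Q) (x : Q → ZMod 2) :
    (tensorOp fun q => pauliZ ^ n q).mulVec ψ x =
      zsign (∑ q, (n q : ZMod 2) * x q) * ψ x := by
  rw [tensorOp_mulVec_of_monomial (g := fun _ a => a) (h := fun q a => zsign (n q * a))
    (fun q a b => pauliZ_pow_apply (n q) a b), zsign_sum]

theorem tensorOp_pauliX_mulVec (n : Q → ℕ) (ψ : QState Q) (x : Q → ZMod 2) :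
    (tensorOp fun q => pauliX ^ n q).mulVec ψ x = ψ (x + fun q => (n q : ZMod 2)) := by
  rw [tensorOp_mulVec_of_monomial (g := fun q a => a + n q) (h := fun _ _ => 1)
    (fun q a b => pauliX_pow_apply (n q) a b), Finset.prod_const_one, one_mul]
  rfl

theorem tensorOp_mul (A B : Q → QubitOp) :
    tensorOp A * tensorOp B = tensorOp fun q => A q * B q := by
  ext x y
  simp only [tensorOp, Matrix.mul_apply, Matrix.of_apply, ← Finset.prod_mul_distrib]
  rw [Finset.prod_univ_sum, Fintype.piFinset_univ]

theorem hadamard_mul_self : hadamard * hadamard = 1 := by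
  have h : ((1 / Real.sqrt 2 : ℝ) : ℂ) * ((1 / Real.sqrt 2 : ℝ) : ℂ) = 1 / 2 := by
    rw [← Complex.ofReal_mul, div_mul_div_comm, Real.mul_self_sqrt zero_le_two]
    norm_num
  rw [hadamard, Matrix.smul_mul, Matrix.mul_smul, smul_smul, h]
  ext i j
  fin_cases i <;> fin_cases j <;> norm_num [Matrix.mul_apply, Fin.sum_univ_two]

theorem hadamard_conjTranspose : hadamard.conjTranspose = hadamard := by
  ext i j
  fin_cases i <;> fin_cases j <;> simp [hadamard, Matrix.conjTranspose_apply]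

theorem hadamardsOn_mul_self (S : Set Q) :
    hadamardsOn S * hadamardsOn S = 1 := by
  rw [hadamardsOn, tensorOp_mul, ← tensorOp_one]
  congr 1
  ext1 q
  split_ifs
  · exact hadamard_mul_self
  · exact one_mul 1

/-- Conjugation by a self-adjoint involution is its own inverse, so mapping the Pauli group into
itself already gives equality. -/
theorem isClifford_of_involutive {U : QubitOp} (hU : U * U = 1) (hU' : U.conjTranspose = U)
    (h : ∀ P ∈ ({1, pauliX, pauliY, pauliZ} : Set QubitOp), U * P * U ∈ pauliGroup) :
    IsClifford U := by
  have h1 : ∀ A ∈ pauliGroup, U * A * U.conjTranspose ∈ pauliGroup := by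
    rintro _ ⟨k, P, hP, rfl⟩
    obtain ⟨l, P', hP', e⟩ := h P hP
    refine ⟨k + l, P', hP', ?_⟩
    rw [hU', Matrix.mul_smul, Matrix.smul_mul, e, smul_smul, pow_add]
  refine ⟨?_, Set.Subset.antisymm (Set.image_subset_iff.2 h1) fun A hA => ⟨_, h1 A hA, ?_⟩⟩
  · rw [Matrix.mem_unitaryGroup_iff, Matrix.star_eq_conjTranspose, hU', hU]
  · simp only [hU']
    rw [mul_assoc, mul_assoc, mul_assoc, hU, mul_one, ← mul_assoc, hU, one_mul]

theorem isClifford_one : IsClifford 1 :=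
  isClifford_of_involutive (one_mul 1) Matrix.conjTranspose_one fun P hP =>
    ⟨0, P, hP, by simp⟩

theorem isClifford_hadamard : IsClifford hadamard := by
  have hX : hadamard * pauliX = pauliZ * hadamard := by
    ext i j
    fin_cases i <;> fin_cases j <;> simp [hadamard, pauliX, pauliZ]
  have hY : hadamard * pauliY = (Complex.I ^ 2 • pauliY) * hadamard := by
    ext i j
    fin_cases i <;> fin_cases j <;> simp [hadamard, pauliY, mul_comm]
  have hZ : hadamard * pauliZ = pauliX * hadamard := by
    ext i j
    fin_cases i <;> fin_cases j <;> simp [hadamard, pauliX, pauliZ]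
  refine isClifford_of_involutive hadamard_mul_self hadamard_conjTranspose ?_
  rintro _ (rfl | rfl | rfl | rfl)
  · exact ⟨0, 1, by simp, by rw [mul_one, hadamard_mul_self, pow_zero, one_smul]⟩
  · exact ⟨0, pauliZ, by simp, by rw [hX, mul_assoc, hadamard_mul_self, mul_one, pow_zero, one_smul]⟩
  · exact ⟨2, pauliY, by simp, by rw [hY, mul_assoc, hadamard_mul_self, mul_one]⟩
  · exact ⟨0, pauliX, by simp, by rw [hZ, mul_assoc, hadamard_mul_self, mul_one, pow_zero, one_smul]⟩

open scoped Classical in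
theorem lcEquiv_of_hadamardsOn {S : Set Q} {φ ψ : QState Q}
    (h : EqUpToPhase ((hadamardsOn S).mulVec ψ) φ) : LCEquiv ψ φ :=
  ⟨fun q => if q ∈ S then hadamard else 1, fun q => by
    beta_reduce
    split_ifs
    · exact isClifford_hadamard
    · exact isClifford_one, h.symm⟩

open scoped Classical in
theorem lcEquiv_of_hadamardsOn' {S : Set Q} {φ ψ : QState Q}
    (h : EqUpToPhase ((hadamardsOn S).mulVec ψ) φ) : LCEquiv φ ψ := by
  obtain ⟨θ, h⟩ := h.symm
  refine lcEquiv_of_hadamardsOn (S := S) (EqUpToPhase.symm ⟨-θ, ?_⟩)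
  rw [h, Matrix.mulVec_smul, Matrix.mulVec_mulVec, hadamardsOn_mul_self, Matrix.one_mulVec,
    smul_smul, ← Complex.exp_add]
  simp

end Operators

/-! ### Graph states of bipartite graphs -/

section GraphState

variable {Q : Type*} [Fintype Q]

-- Every edge has exactly one orientation from outside `T` into `T`, which turns the product over
-- edges into one over ordered pairs.
open scoped Classical in
theorem graphState_apply_of_bipartition [DecidableEq Q] {G : SimpleGraph Q} {T : Set Q}
    (hG : ∀ a b, G.Adj a b → (a ∉ T ∧ b ∈ T) ∨ (b ∉ T ∧ a ∈ T)) (y : Q → ZMod 2) :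
    graphState G y = ((1 / Real.sqrt 2 : ℝ) : ℂ) ^ Fintype.card Q *
      ∏ a, ∏ t, if a ∉ T ∧ t ∈ T ∧ G.Adj a t then zsign (y a * y t) else 1 := by
  have h1 : ∀ x : Q → Fin 2, graphState G x = ((1 / Real.sqrt 2 : ℝ) : ℂ) ^ Fintype.card Q *
      ∏ e ∈ G.edgeFinset, if ∀ q ∈ e, x q = 1 then -1 else 1 := fun x => by
    rw [graphState, czProduct, Matrix.mulVec_diagonal, mul_comm]
    exact congrArg₂ _ rfl (Finset.prod_congr rfl fun e _ => by congr!)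
  refine (h1 y).trans (congrArg _ ?_)
  rw [← Fintype.prod_prod_type' (f := fun a t =>
    if a ∉ T ∧ t ∈ T ∧ G.Adj a t then zsign (y a * y t) else 1), ← Finset.prod_filter]
  symm
  refine Finset.prod_bij (fun p _ => s(p.1, p.2)) ?_ ?_ ?_ ?_
  · rintro ⟨a, t⟩ h
    simpa using (Finset.mem_filter.1 h).2.2.2
  · rintro ⟨a, t⟩ h ⟨a', t'⟩ h' e
    obtain ⟨-, ha, ht, -⟩ := Finset.mem_filter.1 h
    obtain ⟨-, ha', ht', -⟩ := Finset.mem_filter.1 h'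
    rcases Sym2.eq_iff.1 e with ⟨h1, h2⟩ | ⟨h1, h2⟩
    · exact Prod.ext h1 h2
    · exact absurd (h1 ▸ ht') ha
  · intro e he
    induction e using Sym2.ind with
    | _ a b =>
      rw [SimpleGraph.mem_edgeFinset, SimpleGraph.mem_edgeSet] at he
      rcases hG a b he with ⟨ha, hb⟩ | ⟨hb, ha⟩
      · exact ⟨(a, b), by simp [ha, hb, he], rfl⟩
      · exact ⟨(b, a), by simp [ha, hb, he.symm], Sym2.eq_swap⟩
  · rintro ⟨a, t⟩ _
    simp only [Sym2.mem_iff, forall_eq_or_imp, forall_eq]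
    rcases zmod_two_cases (y a) with ha | ha <;> rcases zmod_two_cases (y t) with ht | ht
    all_goals rw [ha, ht]; simp [zsign_one]

end GraphState

/-! ### Planar code states -/

theorem smul_qstate_apply {Q : Type*} (z : ℂ) (ψ : QState Q) (x : Q → ZMod 2) :
    (z • ψ) x = z * ψ x := rfl

namespace PlaneMultigraph

variable {V E F : Type*} (P : PlaneMultigraph V E F)

section

open scoped Classical in
/-- The function with the value `k` on the cut space and `0` elsewhere. -/
noncomputable def cutState (P : PlaneMultigraph V E F) (k : ℂ) : QState E :=
  fun x : E → ZMod 2 => if x ∈ (coboundary P.vert).range then k else 0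

open scoped Classical in
theorem cutState_apply (k : ℂ) (x : E → ZMod 2) :
    P.cutState k x = if x ∈ (coboundary P.vert).range then k else 0 := rfl

variable [Fintype E] [DecidableEq E]

theorem faceStabilizer_mulVec (f : F) (ψ : QState E) (x : E → ZMod 2) :
    (P.faceStabilizer f).mulVec ψ x = zsign ((incidence P.face).mulVec x f) * ψ x :=
  tensorOp_pauliZ_mulVec _ ψ x

theorem vertexStabilizer_mulVec (v : V) (ψ : QState E) (x : E → ZMod 2) :
    (P.vertexStabilizer v).mulVec ψ x = ψ (x + incidence P.vert v) :=
  tensorOp_pauliX_mulVec _ ψ x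

theorem sum_norm_cutState (k : ℂ) : ∑ x, ‖P.cutState k x‖ ^ 2 =
    ‖k‖ ^ 2 * 2 ^ Module.finrank (ZMod 2) (coboundary P.vert).range := by
  classical
  have h1 : ∑ x : E → ZMod 2, ‖P.cutState k x‖ ^ 2 =
      ‖k‖ ^ 2 * 2 ^ Module.finrank (ZMod 2) (coboundary P.vert).range := by
    have h2 : ∀ x : E → ZMod 2, ‖P.cutState k x‖ ^ 2 =
        if x ∈ (coboundary P.vert).range then ‖k‖ ^ 2 else 0 := fun x => by
      rw [cutState_apply]
      split_ifs <;> simp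
    have h3 := Module.card_eq_pow_finrank (K := ZMod 2) (V := (coboundary P.vert).range)
    rw [ZMod.card] at h3
    rw [Finset.sum_congr rfl fun x _ => h2 x, ← Finset.sum_filter, Finset.sum_const, nsmul_eq_mul,
      mul_comm, ← Fintype.card_subtype]
    congr 1
    rw [show Fintype.card {x // x ∈ (coboundary P.vert).range} = _ from h3]
    simp
  exact h1

-- The identity gates on `T` keep only those `x` that agree with `y` on `T`, and the only cut among
-- them is `cutWith P.vert T y`.
open scoped Classical in
theorem hadamardsOn_mulVec_cutState {T : Set E} (hT : P.IsSpanningForest T) (k : ℂ)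
    (y : E → ZMod 2) : (hadamardsOn Tᶜ).mulVec (P.cutState k) y =
      (∏ q, if q ∈ T then 1 else ((1 / Real.sqrt 2 : ℝ) : ℂ)) *
        (∏ a, if a ∈ T then 1 else zsign (y a * cutWith P.vert T y a)) * k := by
  have hF : IsForestOf P.vert T := hT
  have hentry : ∀ q, ∀ _ : Decidable (q ∈ Tᶜ), ∀ a b : ZMod 2,
      (if q ∈ Tᶜ then hadamard else 1 : QubitOp) a b =
        if q ∈ T then if b = a then 1 else 0
          else ((1 / Real.sqrt 2 : ℝ) : ℂ) * zsign (a * b) := by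
    intro q _ a b
    by_cases hq : q ∈ T
    · rw [if_pos hq]
      exact (congrFun (congrFun (if_neg (not_not.2 hq)) a) b).trans
        ((Matrix.one_apply (i := (a : Fin 2)) (j := b)).trans (if_congr eq_comm rfl rfl))
    · rw [if_neg hq]
      exact (congrFun (congrFun (if_pos hq) a) b).trans (hadamard_apply a b)
  have hentries : ∀ x : E → ZMod 2, hadamardsOn Tᶜ y x = ∏ q, if q ∈ T then
      if x q = y q then 1 else 0 else ((1 / Real.sqrt 2 : ℝ) : ℂ) * zsign (y q * x q) :=
    fun x => Finset.prod_congr rfl fun q _ => hentry q _ (y q) (x q)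
  refine (Finset.sum_eq_single (f := fun x : E → Fin 2 => hadamardsOn Tᶜ y x * P.cutState k x)
    (cutWith P.vert T y) (fun x _ hx => ?_) fun h => absurd (Finset.mem_univ _) h).trans ?_
  · have hx' : ∀ x : E → ZMod 2, x ≠ cutWith P.vert T y →
        hadamardsOn Tᶜ y x * P.cutState k x = 0 := by
      intro x hx
      rw [hentries, cutState_apply]
      by_cases hmem : x ∈ (coboundary P.vert).range
      · have : ¬ ∀ t ∈ T, x t = y t := fun h => hx (hF.eq_cutWith hmem h)
        push Not at this
        obtain ⟨t, ht, hne⟩ := this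
        rw [Finset.prod_eq_zero (Finset.mem_univ t) (by rw [if_pos ht, if_neg hne]), zero_mul]
      · rw [if_neg hmem, mul_zero]
    exact hx' x hx
  · have h1 : hadamardsOn Tᶜ y (cutWith P.vert T y) * P.cutState k (cutWith P.vert T y) =
        (∏ q, if q ∈ T then 1 else ((1 / Real.sqrt 2 : ℝ) : ℂ)) *
        (∏ a, if a ∈ T then 1 else zsign (y a * cutWith P.vert T y a)) * k := by
      rw [hentries, cutState_apply, if_pos (hF.cutWith_mem y), ← Finset.prod_mul_distrib]
      congr 1
      refine Finset.prod_congr rfl fun q _ => ?_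
      by_cases hq : q ∈ T
      · simp only [if_pos hq, hF.cutWith_of_mem y hq, if_true, mul_one]
      · simp only [if_neg hq]
    exact h1

open scoped Classical in
theorem graphState_fundamentalGraph_apply [Fintype V] {T : Set E} (hT : P.IsSpanningForest T)
    (y : E → ZMod 2) : graphState (P.fundamentalGraph T) y =
      ((1 / Real.sqrt 2 : ℝ) : ℂ) ^ Fintype.card E *
        ∏ a, if a ∈ T then 1 else zsign (y a * cutWith P.vert T y a) := by
  rw [graphState_apply_of_bipartition (T := T) ?_ y]
  · congr 1
    refine Finset.prod_congr rfl fun a _ => ?_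
    by_cases ha : a ∈ T
    · simp [ha]
    · rw [if_neg ha, cutWith_apply, Finset.mul_sum, zsign_sum]
      refine Finset.prod_congr rfl fun t _ => ?_
      by_cases ht : t ∈ T
      · rw [if_pos ht, P.fundamentalGraph_adj_iff hT ha ht, ← fundamentalCut_eq_zero_iff]
        rcases zmod_two_cases (fundamentalCut P.vert T t a) with h | h <;> simp [ha, ht, h]
      · simp [ht]
  · rintro a b (⟨ha, hb, -⟩ | ⟨hb, ha, -⟩)
    · exact .inl ⟨ha, hb⟩
    · exact .inr ⟨hb, ha⟩

variable [Fintype V] [Fintype F]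

/-- Vertex stabilizers translate by the generators of the cut space, so the amplitude is constant
there. A string that is not a cut violates some face, whose stabilizer makes the amplitude equal to
its own negative. -/
theorem isCodeState_iff (ψ : QState E) : P.IsCodeState ψ ↔
    ∃ k : ℂ, ‖k‖ ^ 2 * 2 ^ Module.finrank (ZMod 2) (coboundary P.vert).range = 1 ∧
      ψ = P.cutState k := by
  classical
  constructor
  · rintro ⟨h1, hf, hv⟩
    have hv' : ∀ v, ∀ x : E → ZMod 2, ψ (x + incidence P.vert v) = ψ x := fun v x =>
      (P.vertexStabilizer_mulVec v ψ x).symm.trans (congrFun (hv v) x)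
    have hshift : ∀ c : V → ZMod 2, ∀ x : E → ZMod 2,
        ψ (x + ∑ v, c v • incidence P.vert v) = ψ x := by
      intro c x
      have : ∀ s : Finset V, ψ (x + ∑ v ∈ s, c v • incidence P.vert v) = ψ x := by
        intro s
        induction s using Finset.induction_on with
        | empty => rw [Finset.sum_empty, add_zero]
        | insert v s hvs ih =>
          rw [Finset.sum_insert hvs]
          rcases zmod_two_cases (c v) with h | h
          · rwa [h, zero_smul, zero_add]
          · rw [h, one_smul, add_comm (incidence P.vert v), ← add_assoc, hv', ih]
      exact this _
    have hψ : ψ = P.cutState (ψ (0 : E → ZMod 2)) := by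
      have : ∀ x : E → ZMod 2, ψ x = P.cutState (ψ (0 : E → ZMod 2)) x := by
        intro x
        rw [cutState_apply]
        split_ifs with hx
        · obtain ⟨c, rfl⟩ := hx
          rw [← hshift c 0, zero_add]
          congr 1
          rw [← transpose_incidence_mulVec]
          ext e
          simp [Matrix.mulVec, dotProduct, mul_comm]
        · rw [← P.face_mulVec_eq_zero_iff] at hx
          obtain ⟨f, hfx⟩ := Function.ne_iff.1 hx
          have h2 := P.faceStabilizer_mulVec f ψ x
          rw [hf, (zmod_two_cases _).resolve_left hfx, zsign_one] at h2
          linear_combination h2 / 2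
      exact funext this
    refine ⟨_, ?_, hψ⟩
    rw [← sum_norm_cutState, ← hψ, h1]
  · rintro ⟨k, hk, rfl⟩
    refine ⟨by rw [sum_norm_cutState, hk], fun f => ?_, fun v => ?_⟩
    · have : ∀ x : E → ZMod 2,
          (P.faceStabilizer f).mulVec (P.cutState k) x = P.cutState k x := by
        intro x
        rw [faceStabilizer_mulVec, cutState_apply]
        split_ifs with hx
        · rw [(P.face_mulVec_eq_zero_iff x).2 hx, Pi.zero_apply, zsign_zero, one_mul]
        · rw [mul_zero]
      exact funext this
    · have : ∀ x : E → ZMod 2,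
          (P.vertexStabilizer v).mulVec (P.cutState k) x = P.cutState k x := by
        intro x
        rw [vertexStabilizer_mulVec, cutState_apply, cutState_apply]
        exact if_congr (Submodule.add_mem_iff_left _ (row_incidence_mem P.vert v)) rfl rfl
      exact funext this

theorem exists_isCodeState : ∃ ψ : QState E, P.IsCodeState ψ := by
  set n := Module.finrank (ZMod 2) (coboundary P.vert).range
  refine ⟨_, (P.isCodeState_iff _).2 ⟨((1 / Real.sqrt (2 ^ n) : ℝ) : ℂ), ?_, rfl⟩⟩
  rw [Complex.norm_real, Real.norm_eq_abs, sq_abs, div_pow, Real.sq_sqrt (by positivity), one_pow]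
  exact one_div_mul_cancel (by positivity)

theorem eqUpToPhase_of_isCodeState {ψ ψ' : QState E} (h : P.IsCodeState ψ)
    (h' : P.IsCodeState ψ') : EqUpToPhase ψ' ψ := by
  obtain ⟨k, hk, rfl⟩ := (P.isCodeState_iff _).1 h
  obtain ⟨k', hk', rfl⟩ := (P.isCodeState_iff _).1 h'
  have hk0 : k ≠ 0 := fun h0 => by simp [h0] at hk
  have hn : ‖k'‖ = ‖k‖ := by
    rw [← hk] at hk'
    exact (sq_eq_sq₀ (norm_nonneg _) (norm_nonneg _)).1 (mul_right_cancel₀ (by positivity) hk')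
  have : P.cutState k' = (k' / k) • P.cutState k := by
    have : ∀ x : E → ZMod 2, P.cutState k' x = ((k' / k) • P.cutState k) x := by
      intro x
      rw [smul_qstate_apply, cutState_apply, cutState_apply]
      split_ifs
      · rw [div_mul_cancel₀ _ hk0]
      · rw [mul_zero]
    exact funext this
  rw [this]
  exact eqUpToPhase_smul (by rw [norm_div, hn, div_self (norm_ne_zero_iff.2 hk0)]) _

theorem hadamardsOn_isCodeState {T : Set E} (hT : P.IsSpanningForest T) {ψ : QState E}
    (hψ : P.IsCodeState ψ) :
    EqUpToPhase ((hadamardsOn Tᶜ).mulVec ψ) (graphState (P.fundamentalGraph T)) := by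
  classical
  have hF : IsForestOf P.vert T := hT
  obtain ⟨k, hk, rfl⟩ := (P.isCodeState_iff _).1 hψ
  rw [hF.finrank_range] at hk
  set r : ℂ := ((1 / Real.sqrt 2 : ℝ) : ℂ) with hr
  have hr2 : ‖r‖ ^ 2 * 2 = 1 := by
    rw [hr, Complex.norm_real, Real.norm_eq_abs, sq_abs, div_pow, Real.sq_sqrt zero_le_two]
    norm_num
  have hr0 : r ≠ 0 := fun h0 => by simp [h0] at hr2
  have hpow : r ^ Fintype.card E = (∏ q, if q ∈ T then 1 else r) * r ^ Nat.card T := by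
    have h1 : r ^ Nat.card T = ∏ q, if q ∈ T then r else 1 := by
      rw [← Finset.prod_filter, Finset.prod_const, Nat.card_eq_fintype_card, Fintype.card_subtype]
    rw [h1, ← Finset.prod_mul_distrib, ← Finset.card_univ, ← Finset.prod_const]
    refine Finset.prod_congr rfl fun q _ => ?_
    split_ifs <;> simp
  have key : (hadamardsOn Tᶜ).mulVec (P.cutState k) =
      (k / r ^ Nat.card T) • graphState (P.fundamentalGraph T) := by
    have : ∀ y : E → ZMod 2, (hadamardsOn Tᶜ).mulVec (P.cutState k) y =
        ((k / r ^ Nat.card T) • graphState (P.fundamentalGraph T)) y := by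
      intro y
      rw [smul_qstate_apply, P.hadamardsOn_mulVec_cutState hT, P.graphState_fundamentalGraph_apply hT,
        ← hr, hpow]
      field_simp
    exact funext this
  rw [key]
  -- The remaining factor has modulus one, since both `‖k‖ ^ 2` and `‖r ^ Nat.card T‖ ^ 2` are the
  -- inverse of the number of cuts.
  refine eqUpToPhase_smul ?_ _
  rw [norm_div, norm_pow, div_eq_one_iff_eq (pow_ne_zero _ (norm_ne_zero_iff.2 hr0)),
    ← sq_eq_sq₀ (norm_nonneg _) (by positivity)]
  refine mul_right_cancel₀ (b := (2 : ℝ) ^ Nat.card T) (by positivity) ?_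
  rw [hk, pow_right_comm, ← mul_pow, hr2, one_pow]

end

end PlaneMultigraph

/-! ### The plane multigraph of a chord diagram -/

section ChordDiagram

open Equiv Equiv.Perm

variable {Q : Type*}

theorem exists_tour_of_injective [Finite Q] [Nonempty Q] {R : Type*} [LinearOrder R]
    {pos : Q × Bool → R} (hpos : Function.Injective pos) :
    ∃ (σ : Perm (Q × Bool)) (pos' : Q × Bool → ℤ), IsTour σ pos' ∧
      (∀ d d', σ.SameCycle d d') ∧ ∀ d d', pos' d < pos' d' ↔ pos d < pos d' := by
  have : Fintype Q := Fintype.ofFinite Q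
  obtain ⟨n, hn⟩ : ∃ n, Fintype.card (Q × Bool) = n + 1 :=
    Nat.exists_eq_succ_of_ne_zero Fintype.card_ne_zero
  obtain ⟨e, he⟩ : ∃ e : Q × Bool ≃ Fin (n + 1), ∀ d d', e d < e d' ↔ pos d < pos d' := by
    let _ : LinearOrder (Q × Bool) := LinearOrder.lift' pos hpos
    exact ⟨(Fintype.orderIsoFinOfCardEq _ hn).symm.toEquiv, fun d d' =>
      (Fintype.orderIsoFinOfCardEq _ hn).symm.lt_iff_lt⟩
  -- The chord ends are numbered in their order and rotated cyclically, which gives a single cycle.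
  set σ : Perm (Q × Bool) := e.trans ((finRotate (n + 1)).trans e.symm) with hσ
  have hσe : ∀ d, (e (σ d) : ℕ) = if e d = Fin.last n then 0 else (e d : ℕ) + 1 := fun d => by
    rw [hσ, Equiv.trans_apply, Equiv.trans_apply, Equiv.apply_symm_apply, finRotate_apply,
      Fin.val_add_one]
  have hcycle : ∀ k, ∀ d, (e d : ℕ) = k → σ.SameCycle (e.symm 0) d := by
    intro k
    induction k with
    | zero =>
      intro d hd
      have : e d = 0 := Fin.ext hd
      rw [← this, Equiv.symm_apply_apply]
    | succ k ih =>
      intro d hd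
      have hk : k < n := by have := (e d).isLt; omega
      set d' := e.symm ⟨k, by omega⟩ with hd'
      have h1 : e d' = ⟨k, by omega⟩ := Equiv.apply_symm_apply _ _
      have h2 : σ d' = d := by
        apply e.injective
        apply Fin.ext
        rw [hσe, h1, if_neg, hd]
        intro h
        have := congrArg Fin.val h
        simp only [Fin.val_last] at this
        omega
      rw [← h2]
      exact (ih d' (by rw [h1])).trans (sameCycle_apply_self σ d')
  refine ⟨σ, fun d => ((e d : ℕ) : ℤ), ⟨fun d d' h => ?_, fun d => ?_⟩,
    fun d d' => (hcycle _ d rfl).symm.trans (hcycle _ d' rfl), fun d d' => ?_⟩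
  · exact e.injective (Fin.ext (Int.ofNat_injective h))
  · have h := hσe d
    by_cases hl : e d = Fin.last n
    · rw [if_pos hl] at h
      refine .inr fun d' _ => ⟨by simp [h], ?_⟩
      have := Fin.le_last (e d')
      rw [← hl] at this
      exact Int.ofNat_le.2 this
    · rw [if_neg hl] at h
      exact .inl (by simp [h])
  · rw [← he, Fin.lt_def]
    exact Nat.cast_lt

/-! ### Noncrossing sets of chords as spanning trees -/

section NonCrossing

variable {W : Type*} {σ : Perm (Q × Bool)} {pos : Q × Bool → ℤ} {S : Set Q}
  {vert : Q × Bool → W}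

/-- Flipping `U` again undoes part of the flip of `S` and leaves that of the noncrossing set `S \
U`, which still contains `t`. So restoring the chords of `S` one at a time always merges two cycles.
-/
theorem IsTour.not_sameCycle_mul_flipOn (h : IsTour σ pos) (hσ : ∀ d d', σ.SameCycle d d')
    (hS : ∀ a ∈ S, ∀ b ∈ S, ¬ Cross pos a b) {U : Set Q} (hU : U ⊆ S) {t : Q} (ht : t ∈ S)
    (htU : t ∉ U) : ¬ (σ * flipOn S * flipOn U).SameCycle (t, false) (t, true) := by
  rw [mul_assoc, flipOn_mul_of_subset hU]
  exact h.not_sameCycle (fun _ => hσ _ _) ⟨ht, htU⟩ fun b hb => hS t ht b hb.1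

variable [Finite Q]

theorem IsTour.sameCycle_iff_edgeReach (h : IsTour σ pos) (hσ : ∀ d d', σ.SameCycle d d')
    (hS : ∀ a ∈ S, ∀ b ∈ S, ¬ Cross pos a b)
    (hvert : ∀ d d', (σ * flipOn S).SameCycle d d' ↔ vert d = vert d') {U : Set Q} (hU : U ⊆ S)
    (d d' : Q × Bool) :
    (σ * flipOn S * flipOn U).SameCycle d d' ↔ EdgeReach vert U (vert d) (vert d') :=
  sameCycle_mul_flipOn_iff hvert (fun _ hU' _ ht htU' =>
    .inr (h.not_sameCycle_mul_flipOn hσ hS (hU'.trans hU) (hU ht) htU')) d d'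

/-- Undoing all flips of `S` recovers `σ`, which is a single cycle. -/
theorem IsTour.edgeReach (h : IsTour σ pos) (hσ : ∀ d d', σ.SameCycle d d')
    (hS : ∀ a ∈ S, ∀ b ∈ S, ¬ Cross pos a b)
    (hvert : ∀ d d', (σ * flipOn S).SameCycle d d' ↔ vert d = vert d')
    (hsurj : Function.Surjective vert) (x y : W) : EdgeReach vert S x y := by
  obtain ⟨d, rfl⟩ := hsurj x
  obtain ⟨d', rfl⟩ := hsurj y
  rw [← h.sameCycle_iff_edgeReach hσ hS hvert subset_rfl, mul_assoc,
    flipOn_mul_of_subset subset_rfl, sdiff_self, Set.bot_eq_empty, flipOn_empty, mul_one]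
  exact hσ d d'

theorem IsTour.isForestOf (h : IsTour σ pos) (hσ : ∀ d d', σ.SameCycle d d')
    (hS : ∀ a ∈ S, ∀ b ∈ S, ¬ Cross pos a b)
    (hvert : ∀ d d', (σ * flipOn S).SameCycle d d' ↔ vert d = vert d')
    (hsurj : Function.Surjective vert) : IsForestOf vert S := by
  refine ⟨fun x y _ => h.edgeReach hσ hS hvert hsurj x y, fun t ht => ?_⟩
  rw [← h.sameCycle_iff_edgeReach hσ hS hvert Set.sdiff_subset]
  exact h.not_sameCycle_mul_flipOn hσ hS Set.sdiff_subset ht fun h => h.2 rfl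

theorem IsTour.card_add_one [Fintype W] [Nonempty Q] (h : IsTour σ pos)
    (hσ : ∀ d d', σ.SameCycle d d') (hS : ∀ a ∈ S, ∀ b ∈ S, ¬ Cross pos a b)
    (hvert : ∀ d d', (σ * flipOn S).SameCycle d d' ↔ vert d = vert d')
    (hsurj : Function.Surjective vert) : Nat.card S + 1 = Nat.card W := by
  have : Fintype Q := Fintype.ofFinite Q
  have : Nonempty W := (inferInstance : Nonempty (Q × Bool)).map vert
  rw [← (h.isForestOf hσ hS hvert hsurj).card_add_numComponents, numComponents_eq_one]
  exact fun x y => (h.edgeReach hσ hS hvert hsurj x y).mono (Set.subset_univ S)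

/-- Labels in `Fin n` keep vertices and faces in `Type`, whatever the universe of `Q`. -/
theorem exists_cycle_labelling (π : Perm (Q × Bool)) :
    ∃ (n : ℕ) (vert : Q × Bool → Fin n), Function.Surjective vert ∧
      ∀ d d', π.SameCycle d d' ↔ vert d = vert d' := by
  have : Finite (Quotient (SameCycle.setoid π)) := Quotient.finite _
  refine ⟨_, fun d => Finite.equivFin (Quotient (SameCycle.setoid π)) (Quotient.mk _ d),
    (Equiv.surjective _).comp Quotient.mk_surjective, fun d d' => ?_⟩
  rw [(Equiv.injective _).eq_iff]
  exact ⟨fun h => Quotient.sound h, fun h => Quotient.exact h⟩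

/-- The plane multigraph whose vertices and faces are the cycles of `σ * flipOn S` and of
`σ * flipOn Sᶜ`. -/
noncomputable def IsTour.planeMultigraph [Nonempty Q] {W X : Type*} [Fintype W] [Fintype X]
    {vert : Q × Bool → W} {face : Q × Bool → X} (h : IsTour σ pos)
    (hσ : ∀ d d', σ.SameCycle d d') (hS : ∀ a ∈ S, ∀ b ∈ S, ¬ Cross pos a b)
    (hS' : ∀ a ∈ Sᶜ, ∀ b ∈ Sᶜ, ¬ Cross pos a b)
    (hvert : ∀ d d', (σ * flipOn S).SameCycle d d' ↔ vert d = vert d')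
    (hface : ∀ d d', (σ * flipOn Sᶜ).SameCycle d d' ↔ face d = face d')
    (hvs : Function.Surjective vert) (hfs : Function.Surjective face) :
    PlaneMultigraph W Q X where
  vert := vert
  rot := σ * flipOn S
  sameCycle_rot_iff := hvert
  face := face
  face_next d := by
    rw [eq_comm, ← hface, ← flipOn_univ_apply, ← Perm.mul_apply, mul_assoc, flipOn_mul_univ]
    exact sameCycle_apply_self _ d
  -- Every vertex has a dart by `hvs`, so this value is irrelevant.
  pointFace _ := face (Classical.arbitrary _)
  linked := by
    set r := Relation.EqvGen (fun x y : W ⊕ X => ∃ a f, x = Sum.inl a ∧ y = Sum.inr f ∧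
      ((∃ d, vert d = a ∧ face d = f) ∨
        ((∀ d, vert d ≠ a) ∧ face (Classical.arbitrary _) = f))) with hr
    have hvf : ∀ d, r (Sum.inl (vert d)) (Sum.inr (face d)) := fun d =>
      .rel _ _ ⟨_, _, rfl, rfl, .inl ⟨d, rfl, rfl⟩⟩
    have hvv : ∀ x y, r (Sum.inl x) (Sum.inl y) := fun x y =>
      (h.edgeReach hσ hS hvert hvs x y).lift (r := fun x y => r (Sum.inl x) (Sum.inl y))
        ⟨fun _ => .refl _, .symm _ _, .trans _ _ _⟩ fun e he => by
          -- For `e ∈ S` the dart `σ (e, false)` starts at the second end of `e` and lies on the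
          -- face of `(e, false)`, so this face touches both ends of `e`.
          have h1 : vert (σ (e, false)) = vert (e, true) := by
            rw [eq_comm, ← hvert]
            have := sameCycle_apply_self (σ * flipOn S) (e, true)
            rwa [Perm.mul_apply, flipOn_of_mem he] at this
          have h2 : face (σ (e, false)) = face (e, false) := by
            rw [eq_comm, ← hface]
            have := sameCycle_apply_self (σ * flipOn Sᶜ) (e, false)
            rwa [Perm.mul_apply, flipOn_of_notMem (not_not.2 he)] at this
          have h3 := hvf (σ (e, false))
          rw [h1, h2] at h3
          exact .trans _ _ _ (hvf _) (.symm _ _ h3)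
    have hall : ∀ x : W ⊕ X, r x (Sum.inl (vert (Classical.arbitrary _))) := by
      rintro (x | f)
      · exact hvv _ _
      · obtain ⟨d, rfl⟩ := hfs f
        exact .trans _ _ _ (.symm _ _ (hvf d)) (hvv _ _)
    exact fun x y => .trans _ _ _ (hall x) (.symm _ _ (hall y))
  euler := by
    have hW : Nonempty W := ⟨vert (Classical.arbitrary _)⟩
    have hc : numComponents vert = 1 := numComponents_eq_one _ fun x y =>
      (h.edgeReach hσ hS hvert hvs x y).mono (Set.subset_univ S)
    -- Two tree counts, for `S` on the vertices and for `Sᶜ` on the faces, add up to Euler's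
    -- formula.
    have h1 := h.card_add_one hσ hS hvert hvs
    have h2 := h.card_add_one hσ hS' hface hfs
    have h3 : Nat.card S + Nat.card (Sᶜ : Set Q) = Nat.card Q := by
      simpa only [Nat.card_coe_set_eq] using Set.ncard_add_ncard_compl S
    rw [hc]
    omega

end NonCrossing

/-- Without chords there are no darts and hence no cycles to serve as vertices; a single point on
the sphere takes their place. -/
theorem exists_planeMultigraph_of_isEmpty [IsEmpty Q] :
    ∃ P : PlaneMultigraph Unit Q Unit, P.Connected :=
  ⟨{  vert := fun _ => ()
      rot := 1
      sameCycle_rot_iff := fun d => isEmptyElim d.1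
      face := fun _ => ()
      face_next := fun _ => rfl
      pointFace := fun _ => ()
      linked := by
        have h : ∀ x : Unit ⊕ Unit, Relation.EqvGen (fun x y : Unit ⊕ Unit => ∃ a f,
            x = Sum.inl a ∧ y = Sum.inr f ∧
              ((∃ d : Q × Bool, () = a ∧ () = f) ∨ ((∀ _ : Q × Bool, () ≠ a) ∧ () = f)))
            (Sum.inl ()) x := by
          rintro (x | x)
          · exact .refl _
          · exact .rel _ _ ⟨(), (), rfl, rfl, .inr ⟨fun d => isEmptyElim d.1, rfl⟩⟩
        exact fun x y => .trans _ _ _ (.symm _ _ (h x)) (h y)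
      euler := by
        rw [numComponents_eq_one _ fun x y => .refl _]
        simp }, ⟨⟨()⟩, fun x y => .refl _⟩⟩

theorem exists_planeMultigraph [Fintype Q] {G : SimpleGraph Q} (hG : G.IsBipartite)
    (hG' : IsCircleGraph G) :
    ∃ (V F : Type) (_ : Fintype V) (_ : Fintype F) (P : PlaneMultigraph V Q F) (T : Set Q),
      P.Connected ∧ P.IsSpanningForest T ∧ P.fundamentalGraph T = G := by
  classical
  rcases isEmpty_or_nonempty Q with hQ | hQ
  · obtain ⟨P, hP⟩ := exists_planeMultigraph_of_isEmpty (Q := Q)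
    obtain ⟨T, hT⟩ := exists_isForestOf P.vert
    exact ⟨Unit, Unit, inferInstance, inferInstance, P, T, hP, hT,
      SimpleGraph.ext (funext fun a => isEmptyElim a)⟩
  obtain ⟨C⟩ := hG
  set T : Set Q := {a | C a = 0} with hT
  have hGT : ∀ a b, G.Adj a b → ¬ (a ∈ T ↔ b ∈ T) := fun a b h h' => by
    have hne := C.valid h
    simp only [hT, Set.mem_ofPred_eq] at h'
    omega
  obtain ⟨pos₀, hpos₀, hadj⟩ := isCircleGraph_iff.1 hG'
  obtain ⟨σ, pos, h, hσ, hlt⟩ := exists_tour_of_injective hpos₀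
  have hcross : ∀ a b, G.Adj a b ↔ Cross pos a b := fun a b => by
    rw [hadj]
    by_cases hab : a = b
    · subst hab
      simp [Cross]
    · rw [and_iff_right hab, cross_congr hlt h.1 hpos₀ (Ne.symm hab)]
  have hS : ∀ a ∈ T, ∀ b ∈ T, ¬ Cross pos a b := fun a ha b hb hc =>
    hGT a b ((hcross a b).2 hc) (iff_of_true ha hb)
  have hS' : ∀ a ∈ Tᶜ, ∀ b ∈ Tᶜ, ¬ Cross pos a b := fun a ha b hb hc =>
    hGT a b ((hcross a b).2 hc) (iff_of_false ha hb)
  obtain ⟨n, vert, hvs, hvert⟩ := exists_cycle_labelling (σ * flipOn T)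
  obtain ⟨m, face, hfs, hface⟩ := exists_cycle_labelling (σ * flipOn Tᶜ)
  set P := h.planeMultigraph hσ hS hS' hvert hface hvs hfs
  have hPT : P.IsSpanningForest T := h.isForestOf hσ hS hvert hvs
  have hPadj : ∀ a t, a ∉ T → t ∈ T → ((P.fundamentalGraph T).Adj a t ↔ G.Adj a t) := by
    intro a t ha ht
    rw [P.fundamentalGraph_adj_iff hPT ha ht, SimpleGraph.adj_comm, hcross,
      h.cross_iff (a := t) (b := a) (fun _ => hσ _ _) fun h => ha (h ▸ ht)]
    -- Restoring all chords of `T` except `t` leaves `σ` times the transposition of the darts of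
    -- `t`, which is the permutation in the crossing criterion.
    refine not_congr ((h.sameCycle_iff_edgeReach hσ hS hvert Set.sdiff_subset _ _).symm.trans ?_)
    rw [mul_assoc, flipOn_mul_of_subset Set.sdiff_subset, Set.sdiff_sdiff_cancel_left,
      flipOn_singleton]
    simpa using ht
  refine ⟨Fin n, Fin m, inferInstance, inferInstance, P, T, ⟨⟨vert (Classical.arbitrary _)⟩,
    fun x y => (h.edgeReach hσ hS hvert hvs x y).mono (Set.subset_univ T)⟩, hPT, ?_⟩
  ext a b
  by_cases ha : a ∈ T <;> by_cases hb : b ∈ T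
  · exact iff_of_false (by simp [PlaneMultigraph.fundamentalGraph, ha, hb]) fun h =>
      hGT a b h (iff_of_true ha hb)
  · rw [SimpleGraph.adj_comm, hPadj b a hb ha, SimpleGraph.adj_comm]
  · exact hPadj a b ha hb
  · exact iff_of_false (by simp [PlaneMultigraph.fundamentalGraph, ha, hb]) fun h =>
      hGT a b h (iff_of_false ha hb)

end ChordDiagram

theorem mainTheorem2 :
    -- from planar code states to bipartite circle graph states
    (∀ (V : Type u) (E : Type v) (F : Type w) [Fintype V] [Fintype E] [DecidableEq E] [Fintype F]
      (P : PlaneMultigraph V E F),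
      (∃ ψ : QState E, P.IsCodeState ψ ∧
        ∀ ψ' : QState E, P.IsCodeState ψ' → EqUpToPhase ψ' ψ) ∧
      (∃ T : Set E, P.IsSpanningForest T) ∧
      ∀ ψ : QState E, P.IsCodeState ψ →
        (∃ G : SimpleGraph E, G.IsBipartite ∧ IsCircleGraph G ∧ LCEquiv ψ (graphState G)) ∧
        ∀ T : Set E, P.IsSpanningForest T →
          (P.fundamentalGraph T).IsBipartite ∧ IsCircleGraph (P.fundamentalGraph T) ∧
          EqUpToPhase ((hadamardsOn Tᶜ).mulVec ψ) (graphState (P.fundamentalGraph T))) ∧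
    -- from bipartite circle graph states to planar code states
    (∀ (Q : Type u) [Fintype Q] [DecidableEq Q] (G : SimpleGraph Q),
      G.IsBipartite → IsCircleGraph G →
      ∃ (V F : Type) (_ : Fintype V) (_ : Fintype F) (P : PlaneMultigraph V Q F),
        P.Connected ∧ ∃ ψ : QState Q, P.IsCodeState ψ ∧ LCEquiv (graphState G) ψ) := by
  constructor
  · intro V E F _ _ _ _ P
    obtain ⟨ψ₀, hψ₀⟩ := P.exists_isCodeState
    obtain ⟨T₀, hT₀⟩ : ∃ T : Set E, P.IsSpanningForest T := exists_isForestOf P.vert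
    refine ⟨⟨ψ₀, hψ₀, fun ψ' => P.eqUpToPhase_of_isCodeState hψ₀⟩, ⟨T₀, hT₀⟩, fun ψ hψ =>
      ⟨⟨P.fundamentalGraph T₀, P.fundamentalGraph_isBipartite T₀,
        P.isCircleGraph_fundamentalGraph hT₀,
        lcEquiv_of_hadamardsOn (P.hadamardsOn_isCodeState hT₀ hψ)⟩, fun T hT =>
      ⟨P.fundamentalGraph_isBipartite T, P.isCircleGraph_fundamentalGraph hT,
        P.hadamardsOn_isCodeState hT hψ⟩⟩⟩
  · intro Q _ _ G hG hG'
    obtain ⟨V, F, _, _, P, T, hP, hT, rfl⟩ := exists_planeMultigraph hG hG'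
    obtain ⟨ψ, hψ⟩ := P.exists_isCodeState
    exact ⟨V, F, inferInstance, inferInstance, P, hP, ψ, hψ,
      lcEquiv_of_hadamardsOn' (P.hadamardsOn_isCodeState hT hψ)⟩
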